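/- Let $I\subseteq[0,1]$ be a set of real numbers satisfying the descending chain condition (DCC), i.e. every decreasing sequence in $I$ is eventually constant. Then there is a finite subset $I_0\subseteq I$ with the following property. Let $k$ be an arbitrary field (of any characteristic, possibly imperfect), let $C$ be a proper regular curve over $k$ (an integral scheme of dimension one, proper over $k$, all of whose local rings are regular; it need be neither smooth nor geometrically integral over $k$), and let $\Delta=\sum_i a_iP_i$ be an $\mathbb{R}$-divisor on $C$, where the $P_i$ are finitely many distinct closed points and all $a_i\neq 0$. Let $K_C$ be a canonical divisor of $C$, i.e. a divisor with $\mathcal{O}_C(K_C)\cong\omega_C$, the dualizing sheaf of $C$ over $k$; equivalently, the divisor of a nonzero Weil differential of the function field of $C$ over $k$. If all coefficients $a_i$ belong to $I$ and $K_C+\Delta\equiv 0$, i.e. $\deg_k(K_C+\Delta)=0$, where $\deg_k(\sum_j r_jQ_j)=\sum_j[k(Q_j):k]\,r_j$, then all $a_i$ belong to $I_0$. The set $I_0$ depends only on $I$, not on $k$, $C$ or $\Delta$. -/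

import Mathlib

open AlgebraicGeometry CategoryTheory

universe u

/-- The descending chain condition: every (weakly) decreasing sequence in `I` is eventually
constant. -/
def IsDCC (I : Set ℝ) : Prop :=
  ∀ a : ℕ → ℝ, (∀ n, a n ∈ I) → Antitone a → ∃ N, ∀ n, N ≤ n → a n = a (n + 1)

/-- A proper regular curve over a field `k`: an integral scheme of dimension one, proper over `k`
(in particular separated and of finite type), all of whose local rings are regular.
It need be neither smooth nor geometrically integral over `k`. -/
structure ProperRegularCurve (k : Type u) [Field k] where
  X : Scheme.{u}
  toBase : X ⟶ Spec (CommRingCat.of k)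
  isIntegral : IsIntegral X
  isProper : IsProper toBase
  dim_eq_one : topologicalKrullDim X = 1
  regular : ∀ x : X, IsRegularLocalRing (X.presheaf.stalk x)

namespace ProperRegularCurve

variable {k : Type u} [Field k] (C : ProperRegularCurve k)

instance : IsIntegral C.X := C.isIntegral

instance : IsProper C.toBase := C.isProper

instance : IsLocallyNoetherian C.X := LocallyOfFiniteType.isLocallyNoetherian C.toBase

/-- The closed points of the curve, i.e. its prime divisors. -/
abbrev ClosedPoint : Type u := {x : C.X // IsClosed ({x} : Set C.X)}

/-- The structure map `k → 𝒪_{C,x}`. -/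
noncomputable def toStalk (x : C.X) : k →+* C.X.presheaf.stalk x :=
  ((Scheme.ΓSpecIso (CommRingCat.of k)).inv ≫ C.toBase.appTop ≫
    C.X.presheaf.germ ⊤ x trivial).hom

/-- The function field `k(C)` as an extension of `k`. -/
noncomputable instance : Algebra k C.X.functionField :=
  (C.toStalk (genericPoint C.X)).toAlgebra

theorem algebraMap_toStalk (x : C.X) (c : k) :
    algebraMap (C.X.presheaf.stalk x) C.X.functionField (C.toStalk x c) =
      algebraMap k C.X.functionField c := by
  have h := C.X.presheaf.germ_stalkSpecializes (U := ⊤) (y := x) trivial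
    ((genericPoint_spec C.X).specializes trivial)
  exact DFunLike.congr_fun (congrArg CommRingCat.Hom.hom h)
    (((Scheme.ΓSpecIso (CommRingCat.of k)).inv ≫ C.toBase.appTop).hom c)

/-- The residue field `k(P)` as an extension of `k`. -/
noncomputable instance (x : C.X) : Algebra k (C.X.residueField x) :=
  ((C.X.residue x).hom.comp (C.toStalk x)).toAlgebra

/-- Weil divisors with coefficients in `R`: finite formal sums `∑ rᵢ Pᵢ` of closed points. -/
abbrev WeilDivisor (R : Type*) [Zero R] : Type _ := C.ClosedPoint →₀ R

variable {C}

/-- The set of coefficients of a divisor: the multiplicities of its components. -/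
def WeilDivisor.coeffs {R : Type*} [Zero R] (D : C.WeilDivisor R) : Set R :=
  {r | ∃ P ∈ D.support, D P = r}

/-- An integral divisor viewed as an `ℝ`-divisor. -/
noncomputable def WeilDivisor.toReal (D : C.WeilDivisor ℤ) : C.WeilDivisor ℝ :=
  D.mapRange (fun n : ℤ => (n : ℝ)) Int.cast_zero

/-- The degree over `k`: `deg_k (∑ rᵢ Pᵢ) = ∑ [k(Pᵢ) : k] rᵢ`. -/
noncomputable def WeilDivisor.degree (D : C.WeilDivisor ℝ) : ℝ :=
  D.sum fun P r => (Module.finrank k (C.X.residueField P.1) : ℝ) * r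

/-- `D ≡ 0`: the intersection number of `D` with every proper curve in `C` vanishes. The only
such curve is `C` itself and the number is `deg_k D`. -/
def WeilDivisor.IsNumTrivial (D : C.WeilDivisor ℝ) : Prop := D.degree = 0

variable (C)

/-- The repartitions (adeles) of `C`: families `(α_P)` of rational functions, indexed by the
closed points, such that `α_P ∈ 𝒪_{C,P}` for all but finitely many `P`. -/
noncomputable def adele : Submodule k (C.ClosedPoint → C.X.functionField) where
  carrier := {α | ∀ᶠ P in Filter.cofinite,
    α P ∈ (algebraMap (C.X.presheaf.stalk P.1) C.X.functionField).range}
  zero_mem' := by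
    simp only [Set.mem_ofPred_eq]
    exact Filter.Eventually.of_forall fun P => zero_mem _
  add_mem' := by
    intro α β ha hb
    simp only [Set.mem_ofPred_eq] at ha hb ⊢
    filter_upwards [ha, hb] with P h₁ h₂ using add_mem h₁ h₂
  smul_mem' := by
    intro c α h
    simp only [Set.mem_ofPred_eq] at h ⊢
    filter_upwards [h] with P hP
    rw [Pi.smul_apply, Algebra.smul_def]
    exact mul_mem ⟨C.toStalk P.1 c, C.algebraMap_toStalk P.1 c⟩ hP

variable {C}

/-- `α ∈ 𝔸(D)`, i.e. `v_P(α_P) + D(P) ≥ 0` for all `P`, with `v_P(0) = ∞`. -/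
def MemAdele (D : C.WeilDivisor ℤ) (α : C.ClosedPoint → C.X.functionField) : Prop :=
  ∀ P, α P = 0 ∨ 0 ≤ Scheme.ord (α P) P.1 + D P

/-- `K` is a canonical divisor of `C`, i.e. the divisor of a nonzero Weil differential `ω`:
a `k`-linear functional on the adeles which vanishes on the diagonally embedded rational functions,
and on `𝔸(D)` exactly for the divisors `D ≤ K`.

As `H¹(C, 𝒪(D)) = 𝔸 / (𝔸(D) + k(C))`, such functionals are the rational sections of the dualizing
sheaf `ω_C`, and `𝒪(K) ≅ ω_C`. This also covers curves which are not smooth over `k`, where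
Kähler differentials do not give `ω_C`. -/
def IsCanonical (K : C.WeilDivisor ℤ) : Prop :=
  ∃ ω : C.adele →ₗ[k] k, ω ≠ 0 ∧
    (∀ α : C.adele, (∃ f, ∀ P, α.1 P = f) → ω α = 0) ∧
    ∀ D : C.WeilDivisor ℤ, (∀ α : C.adele, MemAdele D α.1 → ω α = 0) ↔ D ≤ K

end ProperRegularCurve

/-! If `Δ ≠ 0`, its coefficients are positive, so `deg K = -deg Δ < 0`, and Riemann–Roch pins down
`deg K`. Let `d` be the degree over `k` of the field of constants, that is `ℓ(0)`. Negativity of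
`deg K` forces both `ℓ(K)` and the index of speciality of `0` to vanish, and the Riemann–Roch
equations at `0` and at `K` then give `deg K = -2d` (`degree_canonical`). Every residue field is a
quotient of a module over the field of constants, so `[k(P) : k] = d * m P`
(`finrank_sections_zero_dvd`). Dividing `deg Δ = 2d` by `d` gives `∑ m P * Δ P = 2` with positive
integers `m P`, an equation in which `k` and `C` no longer occur.

The rest is combinatorial. By DCC the positive elements of `I` are bounded below, so the number of
summands, counted with multiplicity, is bounded. Tuples of fixed length and fixed sum form an
antichain in a partially well-ordered set, hence a finite set (`IsDCC.finite_tuples`). Their entries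
make up `I₀`.

As `C` may fail to be smooth, Riemann–Roch is proved by Weil's method, for an abstract family of
discrete valuations on a field `F`. Four properties suffice (`IsComplete`): finite residue degrees,
no inclusions between valuation rings, finiteness of `F` over `k(x)` and existence of a pole, for
transcendental `x`. For a curve they come from the Nullstellensatz, separatedness, dimension one and
the valuative criterion of properness. -/

namespace Submodule

/-! ### Relative dimension of subspaces. -/

variable {k V W : Type*} [Field k] [AddCommGroup V] [Module k V] [AddCommGroup W] [Module k W]

/-- The dimension of `B / (A ∩ B)`, as an extended natural number. -/
noncomputable def relLength (A B : Submodule k V) : ℕ∞ :=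
  Module.length k (B ⧸ A.submoduleOf B)

theorem relLength_eq_zero {A B : Submodule k V} : relLength A B = 0 ↔ B ≤ A := by
  rw [relLength, Module.length_eq_zero_iff, Submodule.Quotient.subsingleton_iff, Submodule.submoduleOf,
    Submodule.comap_subtype_eq_top]

theorem relLength_bot (B : Submodule k V) : relLength ⊥ B = Module.length k B := by
  have h : (⊥ : Submodule k V).submoduleOf B = ⊥ := by
    ext x; simp [Submodule.submoduleOf]
  rw [relLength, h]
  exact (Submodule.quotEquivOfEqBot _ rfl).length_eq

theorem relLength_inf_right (A B : Submodule k V) : relLength (A ⊓ B) B = relLength A B := by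
  have h : (A ⊓ B).submoduleOf B = A.submoduleOf B := by
    ext x; simp [Submodule.submoduleOf]
  rw [relLength, relLength, h]

/-- The second isomorphism theorem for relative lengths. -/
theorem relLength_sup (A B : Submodule k V) : relLength A (A ⊔ B) = relLength A B := by
  have h := (LinearMap.quotientInfEquivSupQuotient B A).length_eq
  have h1 : A ⊔ B = B ⊔ A := sup_comm _ _
  rw [← relLength_inf_right A B, h1, inf_comm A B]
  exact h.symm

theorem relLength_trans {A B C : Submodule k V} (h₁ : A ≤ B) (h₂ : B ≤ C) :
    relLength A C = relLength A B + relLength B C := by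
  let f : (B ⧸ A.submoduleOf B) →ₗ[k] (C ⧸ A.submoduleOf C) :=
    Submodule.mapQ _ _ (Submodule.inclusion h₂) (fun x hx => hx)
  let g : (C ⧸ A.submoduleOf C) →ₗ[k] (C ⧸ B.submoduleOf C) :=
    Submodule.factor (fun x hx => h₁ hx)
  refine Module.length_eq_add_of_exact f g ?_ (Submodule.factor_surjective _) ?_
  · rw [← LinearMap.ker_eq_bot]
    refine Submodule.ker_liftQ_eq_bot _ _ _ (fun x hx => ?_)
    have h3 : Submodule.Quotient.mk (p := A.submoduleOf C) (Submodule.inclusion h₂ x) = 0 := hx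
    exact (Submodule.Quotient.mk_eq_zero (A.submoduleOf C)).1 h3
  · intro y
    obtain ⟨y, rfl⟩ := Submodule.Quotient.mk_surjective _ y
    have : g (Submodule.Quotient.mk y) = Submodule.Quotient.mk y := rfl
    rw [this, Submodule.Quotient.mk_eq_zero]
    constructor
    · intro hy
      exact ⟨Submodule.Quotient.mk ⟨y.1, hy⟩, rfl⟩
    · rintro ⟨x, hx⟩
      obtain ⟨x, rfl⟩ := Submodule.Quotient.mk_surjective _ x
      have h : f (Submodule.Quotient.mk x) = Submodule.Quotient.mk (Submodule.inclusion h₂ x) := rfl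
      rw [h, Submodule.Quotient.eq] at hx
      have h3 := B.sub_mem x.2 (h₁ hx)
      simpa [Submodule.submoduleOf] using h3

theorem relLength_le_of_le {A B C : Submodule k V} (h : B ≤ C) : relLength A B ≤ relLength A C := by
  rw [← relLength_sup A B, ← relLength_sup A C,
    relLength_trans (le_sup_left : A ≤ A ⊔ B) (sup_le_sup_left h A)]
  exact le_self_add

/-- A pair `A ≤ B` splits into its intersection with and its sum with a third subspace. -/
theorem relLength_eq_inf_add_sup {A B : Submodule k V} (h : A ≤ B) (F : Submodule k V) :
    relLength A B = relLength (A ⊓ F) (B ⊓ F) + relLength (A ⊔ F) (B ⊔ F) := by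
  -- The intermediate space `A ⊔ B ⊓ F` cuts `A ≤ B` into two steps; by the second isomorphism
  -- theorem the lower one is the intersection part and, with the modular law, the upper one is the
  -- sum part.
  have e1 : relLength (A ⊓ F) (B ⊓ F) = relLength A (A ⊔ B ⊓ F) := by
    rw [relLength_sup, ← relLength_inf_right A]
    congr 1
    rw [← inf_assoc, inf_eq_left.2 h]
  have e2 : relLength (A ⊔ F) (B ⊔ F) = relLength (A ⊔ B ⊓ F) B := by
    have : B ⊔ F = (A ⊔ F) ⊔ B := by
      rw [sup_comm A F, sup_assoc, sup_eq_right.2 h, sup_comm]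
    rw [this, relLength_sup, ← relLength_inf_right]
    congr 1
    rw [sup_inf_assoc_of_le F h, inf_comm]
  rw [e1, e2]
  exact relLength_trans le_sup_left (sup_le h inf_le_left)

theorem relLength_map {f : V →ₗ[k] W} (hf : Function.Injective f) (A B : Submodule k V) :
    relLength (A.map f) (B.map f) = relLength A B := by
  refine (LinearEquiv.length_eq (Submodule.Quotient.equiv _ _
    (Submodule.equivMapOfInjective f hf B) ?_)).symm
  ext x
  obtain ⟨x, rfl⟩ := (Submodule.equivMapOfInjective f hf B).surjective x
  simp [Submodule.submoduleOf, hf.eq_iff]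

theorem relLength_comap {f : V →ₗ[k] W} (hf : Function.Injective f) (A B : Submodule k W) :
    relLength (A.comap f) (B.comap f) = relLength (A ⊓ LinearMap.range f) (B ⊓ LinearMap.range f) := by
  rw [← relLength_map hf, Submodule.map_comap_eq, Submodule.map_comap_eq, inf_comm, inf_comm B]

end Submodule

/-! ### Places, divisors and the local dimension count. -/

section

open Submodule WithZero

/-- A family of normalized discrete valuations of a field `F`, trivial on a subfield `k`. -/
structure PlaceFamily (k F ι : Type*) [Field k] [Field F] [Algebra k F] where
  /-- The valuations. -/
  v : ι → Valuation F (WithZero (Multiplicative ℤ))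
  map_const : ∀ P c, v P (algebraMap k F c) ≤ 1
  surjective : ∀ P, Function.Surjective (v P)

namespace PlaceFamily

variable {k F ι : Type*} [Field k] [Field F] [Algebra k F] (𝓥 : PlaceFamily k F ι)

theorem map_smul_le (P : ι) (c : k) (x : F) : 𝓥.v P (c • x) ≤ 𝓥.v P x := by
  rw [Algebra.smul_def, map_mul]
  exact mul_le_of_le_one_left' (𝓥.map_const P c)

/-- The fractional ideal of functions with a pole of order at most `n` at `P`. -/
def localIdeal (P : ι) (n : ℤ) : Submodule k F where
  carrier := {x | 𝓥.v P x ≤ exp n}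
  zero_mem' := by simp
  add_mem' := fun ha hb => (𝓥.v P).map_add_le ha hb
  smul_mem' := fun c _ hx => (𝓥.map_smul_le P c _).trans hx

@[simp]
theorem mem_localIdeal {P : ι} {n : ℤ} {x : F} : x ∈ 𝓥.localIdeal P n ↔ 𝓥.v P x ≤ exp n :=
  Iff.rfl

theorem localIdeal_mono (P : ι) {m n : ℤ} (h : m ≤ n) : 𝓥.localIdeal P m ≤ 𝓥.localIdeal P n :=
  fun _ hx => le_trans hx (exp_le_exp.2 h)

/-- The families of functions with poles bounded by `D`. -/
def box (D : ι → ℤ) : Submodule k (ι → F) where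
  carrier := {α | ∀ P, 𝓥.v P (α P) ≤ exp (D P)}
  zero_mem' := by simp
  add_mem' := fun ha hb P => (𝓥.v P).map_add_le (ha P) (hb P)
  smul_mem' := fun c _ hx P => (𝓥.map_smul_le P c _).trans (hx P)

theorem box_mono {D D' : ι → ℤ} (h : D ≤ D') : 𝓥.box D ≤ 𝓥.box D' :=
  fun _ hx P => le_trans (hx P) (exp_le_exp.2 (h P))

/-- The residue degree at `P`. -/
noncomputable def resDegree (P : ι) : ℕ :=
  (relLength (𝓥.localIdeal P (-1)) (𝓥.localIdeal P 0)).toNat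

/-- All residue degrees are finite. -/
def FiniteResidue : Prop := ∀ P, relLength (𝓥.localIdeal P (-1)) (𝓥.localIdeal P 0) ≠ ⊤

variable {𝓥}

theorem exists_eq_exp (P : ι) (n : ℤ) : ∃ t, t ≠ 0 ∧ 𝓥.v P t = exp n := by
  obtain ⟨t, ht⟩ := 𝓥.surjective P (exp n)
  exact ⟨t, fun h => exp_ne_zero (by rw [← ht, h, map_zero]), ht⟩

/-- Multiplication by a function of value `exp a` at `P` shifts the whole filtration. -/
theorem relLength_localIdeal_add (P : ι) (m n a : ℤ) :
    relLength (𝓥.localIdeal P (m + a)) (𝓥.localIdeal P (n + a)) =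
      relLength (𝓥.localIdeal P m) (𝓥.localIdeal P n) := by
  obtain ⟨t, ht, hv⟩ := 𝓥.exists_eq_exp P a
  have key : ∀ n, 𝓥.localIdeal P (n + a) = (𝓥.localIdeal P n).map (LinearMap.mulLeft k t) := by
    intro n
    ext x
    simp only [mem_localIdeal, mem_map, LinearMap.mulLeft_apply]
    constructor
    · intro hx
      refine ⟨t⁻¹ * x, ?_, by field_simp⟩
      rw [map_mul, map_inv₀, hv, ← exp_neg]
      calc exp (-a) * 𝓥.v P x ≤ exp (-a) * exp (n + a) := by gcongr
        _ = exp n := by rw [← exp_add]; congr 1; ring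
    · rintro ⟨y, hy, rfl⟩
      rw [map_mul, hv, add_comm n a, exp_add]
      gcongr
  rw [key, key, relLength_map (mul_right_injective₀ ht)]

theorem relLength_localIdeal (h : 𝓥.FiniteResidue) (P : ι) (n : ℤ) (e : ℕ) :
    relLength (𝓥.localIdeal P n) (𝓥.localIdeal P (n + e)) = (e * 𝓥.resDegree P : ℕ) := by
  induction e with
  | zero => simp [relLength_eq_zero]
  | succ e ih =>
    rw [relLength_trans (𝓥.localIdeal_mono P (by omega : n ≤ n + e))
      (𝓥.localIdeal_mono P (by push_cast; omega)), ih]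
    have := 𝓥.relLength_localIdeal_add P (-1) 0 (n + e + 1)
    rw [show -1 + (n + e + 1) = n + e by ring, show 0 + (n + e + 1) = n + (e + 1 : ℕ) by
      push_cast; ring] at this
    rw [this, ← ENat.natCast_toNat (h P), ← resDegree]
    push_cast
    ring

theorem relLength_box_single [DecidableEq ι] (h : 𝓥.FiniteResidue) (D : ι → ℤ) (P : ι) (e : ℕ) :
    relLength (𝓥.box D) (𝓥.box (D + Pi.single P (e : ℤ))) = (e * 𝓥.resDegree P : ℕ) := by
  have e1 : 𝓥.box (D + Pi.single P (e : ℤ)) = 𝓥.box D ⊔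
      (𝓥.localIdeal P (D P + e)).map (LinearMap.single k (fun _ => F) P) := by
    apply le_antisymm
    · intro α hα
      have : α = Function.update α P 0 + LinearMap.single k (fun _ => F) P (α P) := by
        ext Q
        by_cases hQ : Q = P
        · subst hQ; simp
        · simp [hQ]
      rw [this]
      refine Submodule.add_mem_sup ?_ (Submodule.mem_map_of_mem ?_)
      · intro Q
        by_cases hQ : Q = P
        · subst hQ; simp
        · simpa [hQ] using hα Q
      · simpa using hα P
    · refine sup_le (𝓥.box_mono ?_) ?_
      · intro Q
        by_cases hQ : Q = P
        · subst hQ; simp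
        · simp [hQ]
      · rintro _ ⟨x, hx, rfl⟩ Q
        by_cases hQ : Q = P
        · subst hQ; simpa using hx
        · simp [hQ]
  have hinj : Function.Injective (LinearMap.single k (fun _ : ι => F) P) :=
    fun a b hab => by simpa using congrFun hab P
  rw [e1, relLength_sup, ← relLength_inf_right, ← relLength_localIdeal h P (D P) e,
    ← relLength_map hinj]
  congr 1
  ext α
  constructor
  · rintro ⟨h1, x, hx, rfl⟩
    refine ⟨x, ?_, rfl⟩
    simpa using h1 P
  · rintro ⟨x, hx, rfl⟩
    refine ⟨?_, x, 𝓥.localIdeal_mono P (by omega) hx, rfl⟩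
    intro Q
    by_cases hQ : Q = P
    · subst hQ; simpa using hx
    · simp [hQ]

/-- The degree of an effective divisor. -/
noncomputable def effDegree (𝓥 : PlaceFamily k F ι) (E : ι →₀ ℕ) : ℕ :=
  E.sum fun P n => n * 𝓥.resDegree P

theorem relLength_box (h : 𝓥.FiniteResidue) (D : ι → ℤ) (E : ι →₀ ℕ) :
    relLength (𝓥.box D) (𝓥.box (fun P => D P + E P)) = 𝓥.effDegree E := by
  classical
  induction E using Finsupp.induction_linear generalizing D with
  | zero => simp [effDegree, relLength_eq_zero]
  | add E₁ E₂ h₁ h₂ =>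
    rw [relLength_trans (B := 𝓥.box (fun P => D P + E₁ P)) (𝓥.box_mono fun P => by simp)
      (𝓥.box_mono fun P => by simp), h₁]
    have := h₂ (fun P => D P + E₁ P)
    simp only [add_assoc] at this
    simp only [Finsupp.coe_add, Pi.add_apply, Nat.cast_add]
    rw [this, effDegree, effDegree, effDegree, Finsupp.sum_add_index'] <;> simp [add_mul]
  | single P e =>
    have : (fun Q => D Q + (Finsupp.single P e Q : ℤ)) = D + Pi.single P (e : ℤ) := by
      ext Q
      by_cases hQ : Q = P
      · subst hQ; simp
      · simp [hQ]
    rw [this, relLength_box_single h]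
    simp [effDegree]

/-- The diagonal embedding of the rational functions. -/
def diag (k F ι : Type*) [Field k] [Field F] [Algebra k F] : F →ₗ[k] (ι → F) :=
  LinearMap.pi fun _ => LinearMap.id

@[simp]
theorem diag_apply (f : F) (P : ι) : diag k F ι f P = f := rfl

theorem diag_injective [Nonempty ι] : Function.Injective (diag k F ι) := by
  intro f g h
  exact congrFun h (Classical.arbitrary ι)

/-- The rational functions with poles bounded by `D`. -/
def sections (𝓥 : PlaceFamily k F ι) (D : ι → ℤ) : Submodule k F :=
  (𝓥.box D).comap (diag k F ι)

theorem sections_mono {D D' : ι → ℤ} (h : D ≤ D') : 𝓥.sections D ≤ 𝓥.sections D' :=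
  Submodule.comap_mono (𝓥.box_mono h)

/-- The germ of Riemann–Roch: the dimension `deg E` gained by the box splits into the part meeting
the diagonal field `F`, which is the gain in sections, and the part modulo `F`. -/
theorem effDegree_eq [Nonempty ι] (h : 𝓥.FiniteResidue) (D : ι → ℤ) (E : ι →₀ ℕ) :
    (𝓥.effDegree E : ℕ∞) =
      relLength (𝓥.sections D) (𝓥.sections (fun P => D P + E P)) +
      relLength (𝓥.box D ⊔ LinearMap.range (diag k F ι))
        (𝓥.box (fun P => D P + E P) ⊔ LinearMap.range (diag k F ι)) := by
  rw [← relLength_box h D E, sections, sections, relLength_comap diag_injective]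
  exact relLength_eq_inf_add_sup (𝓥.box_mono fun P => by simp) _

end PlaceFamily

/-! ### Weak approximation and the number of zeros of a function. -/

theorem WithZero.eventually_pow_mul_lt {a : WithZero (Multiplicative ℤ)} (ha : a < 1)
    (b : WithZero (Multiplicative ℤ)) (m : ℤ) :
    ∀ᶠ N : ℕ in Filter.atTop, a ^ N * b < exp m := by
  rcases eq_or_ne b 0 with rfl | hb
  · simp
  rcases eq_or_ne a 0 with rfl | ha0
  · filter_upwards [Filter.eventually_ge_atTop 1] with N hN
    rw [zero_pow (by omega), zero_mul]
    exact exp_pos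
  · filter_upwards [Filter.eventually_ge_atTop (log b - m + 1).toNat] with N hN
    have h1 : log a < 0 := by
      rw [← log_one]; exact (log_lt_log ha0 one_ne_zero).2 ha
    rw [← log_lt_iff_lt_exp (mul_ne_zero (pow_ne_zero _ ha0) hb), log_mul (pow_ne_zero _ ha0) hb,
      log_pow, nsmul_eq_mul]
    have h2 : log b - m + 1 ≤ N := by omega
    nlinarith

namespace PlaceFamily

variable {k F ι : Type*} [Field k] [Field F] [Algebra k F] {𝓥 : PlaceFamily k F ι}

/-- No valuation ring of the family is contained in another one. -/
def Independent (𝓥 : PlaceFamily k F ι) : Prop :=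
  ∀ P Q, P ≠ Q → ∃ x, 𝓥.v P x ≤ 1 ∧ 1 < 𝓥.v Q x

theorem map_one_add_of_one_lt {P : ι} {x : F} (h : 1 < 𝓥.v P x) : 𝓥.v P (1 + x) = 𝓥.v P x := by
  exact Valuation.map_add_eq_of_lt_right _ (by simpa using h)

theorem map_one_add_of_lt_one {P : ι} {x : F} (h : 𝓥.v P x < 1) : 𝓥.v P (1 + x) = 1 := by
  rw [Valuation.map_add_eq_of_lt_left _ (by simpa using h), map_one]

theorem Independent.exists_one_lt_lt_one (h : 𝓥.Independent) {P Q : ι} (hPQ : P ≠ Q) :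
    ∃ x, 1 < 𝓥.v P x ∧ 𝓥.v Q x < 1 := by
  obtain ⟨x, hx, hx'⟩ := h P Q hPQ
  obtain ⟨y, hy, hy'⟩ := h Q P hPQ.symm
  have hx0 : x ≠ 0 := by rintro rfl; simp at hx'
  refine ⟨y / x, ?_, ?_⟩
  · rw [map_div₀, one_lt_div₀ (by simpa [zero_lt_iff] using hx0)]
    exact hx.trans_lt hy'
  · rw [map_div₀, div_lt_one₀ (by simpa [zero_lt_iff] using hx0)]
    exact hy.trans_lt hx'

theorem Independent.exists_one_lt_forall_lt_one (h : 𝓥.Independent) (P : ι) (S : Finset ι)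
    (hP : P ∉ S) : ∃ x, 1 < 𝓥.v P x ∧ ∀ Q ∈ S, 𝓥.v Q x < 1 := by
  classical
  induction S using Finset.induction_on with
  | empty =>
    obtain ⟨t, -, ht⟩ := 𝓥.exists_eq_exp P 1
    exact ⟨t, by rw [ht, ← exp_zero]; exact exp_lt_exp.2 one_pos, by simp⟩
  | insert Q S hQ ih =>
    rw [Finset.mem_insert, not_or] at hP
    obtain ⟨z, hz, hzS⟩ := ih hP.2
    obtain ⟨y, hy, hyQ⟩ := h.exists_one_lt_lt_one hP.1
    have hev : ∀ᶠ N : ℕ in Filter.atTop, ∀ R ∈ S, 𝓥.v R z ^ N * 𝓥.v R y < exp 0 :=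
      (Filter.eventually_all_finset S).2 fun R hR =>
        WithZero.eventually_pow_mul_lt (hzS R hR) _ _
    obtain ⟨N, hN, hN1⟩ := (hev.and (Filter.eventually_ge_atTop 1)).exists
    rw [exp_zero] at hN
    have hN0 : N ≠ 0 := by omega
    -- High powers of `z` settle the places of `S`. If `z` has a pole at `Q`, the power is replaced
    -- by `z ^ N / (1 + z ^ N)`, which has value one where `z` has a pole and is small where `z` has
    -- a zero.
    rcases le_or_gt (𝓥.v Q z) 1 with hzQ | hzQ
    · refine ⟨z ^ N * y, ?_, ?_⟩
      · rw [map_mul, map_pow]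
        exact one_lt_mul_of_lt_of_le' (one_lt_pow₀ hz hN0) hy.le
      · intro R hR
        rw [map_mul, map_pow]
        rcases Finset.mem_insert.1 hR with rfl | hR
        · exact (mul_le_of_le_one_left' (pow_le_one₀ zero_le hzQ)).trans_lt hyQ
        · exact hN R hR
    · have h1 : ∀ R, 1 < 𝓥.v R z → 𝓥.v R (z ^ N / (1 + z ^ N) * y) = 𝓥.v R y := by
        intro R hR
        have h2 : 1 < 𝓥.v R (z ^ N) := by rw [map_pow]; exact one_lt_pow₀ hR hN0
        rw [map_mul, map_div₀, map_one_add_of_one_lt h2, div_self (zero_lt_one.trans h2).ne',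
          one_mul]
      refine ⟨z ^ N / (1 + z ^ N) * y, (h1 P hz).symm ▸ hy, ?_⟩
      intro R hR
      rcases Finset.mem_insert.1 hR with rfl | hR
      · exact (h1 _ hzQ).symm ▸ hyQ
      · have h2 : 𝓥.v R (z ^ N) < 1 := by rw [map_pow]; exact pow_lt_one₀ zero_le (hzS R hR) hN0
        rw [map_mul, map_div₀, map_one_add_of_lt_one h2, div_one, map_pow]
        exact hN R hR

/-- Weak approximation for a finite family of places. -/
theorem Independent.box_sup_diag [Finite ι] (h : 𝓥.Independent) (D : ι → ℤ) :
    𝓥.box D ⊔ LinearMap.range (diag k F ι) = ⊤ := by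
  classical
  cases nonempty_fintype ι
  have key : ∀ P a, Pi.single P a ∈ 𝓥.box D ⊔ LinearMap.range (diag k F ι) := by
    intro P a
    obtain ⟨x, hx, hxS⟩ := h.exists_one_lt_forall_lt_one P (Finset.univ.erase P) (by simp)
    have hx0 : x ≠ 0 := by rintro rfl; simp at hx
    have hev : ∀ᶠ N : ℕ in Filter.atTop, ∀ R ∈ Finset.univ.erase P,
        𝓥.v R x ^ N * 𝓥.v R a < exp (D R) :=
      (Filter.eventually_all_finset _).2 fun R hR =>
        WithZero.eventually_pow_mul_lt (hxS R hR) _ _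
    have hev' : ∀ᶠ N : ℕ in Filter.atTop, 𝓥.v P x⁻¹ ^ N * 𝓥.v P a < exp (D P) :=
      WithZero.eventually_pow_mul_lt (by rw [map_inv₀]; exact inv_lt_one_of_one_lt₀ hx) _ _
    obtain ⟨N, ⟨hN, hN'⟩, hN1⟩ := ((hev.and hev').and (Filter.eventually_ge_atTop 1)).exists
    have hN0 : N ≠ 0 := by omega
    have h2 : 1 < 𝓥.v P (x ^ N) := by rw [map_pow]; exact one_lt_pow₀ hx hN0
    have h3 : 1 + x ^ N ≠ 0 := by
      intro h0
      have := map_one_add_of_one_lt h2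
      rw [h0, map_zero] at this
      rw [← this] at h2
      simp at h2
    -- For large `N` the factor `x ^ N / (1 + x ^ N)` is close to `1` at `P` and to `0` at the other
    -- places, so the diagonal element approximates the family supported at `P`.
    have : (Pi.single P a : ι → F) = (Pi.single P a - diag k F ι (x ^ N / (1 + x ^ N) * a)) +
      diag k F ι (x ^ N / (1 + x ^ N) * a) := by abel
    rw [this]
    refine Submodule.add_mem_sup ?_ ⟨_, rfl⟩
    intro R
    by_cases hR : R = P
    · subst hR
      have e : a - x ^ N / (1 + x ^ N) * a = a / (1 + x ^ N) := by field_simp; ring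
      simp only [Pi.sub_apply, Pi.single_eq_same, diag_apply, e]
      rw [map_div₀, map_one_add_of_one_lt h2, map_pow, div_eq_mul_inv, mul_comm, ← inv_pow,
        ← map_inv₀]
      exact hN'.le
    · have hR' : R ∈ Finset.univ.erase P := by simp [hR]
      have h4 : 𝓥.v R (x ^ N) < 1 := by rw [map_pow]; exact pow_lt_one₀ zero_le (hxS R hR') hN0
      simp only [Pi.sub_apply, Pi.single_eq_of_ne hR, diag_apply, zero_sub, Valuation.map_neg]
      rw [map_mul, map_div₀, map_one_add_of_lt_one h4, div_one, map_pow]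
      exact (hN R hR').le
  rw [eq_top_iff]
  rintro α -
  rw [← Finset.univ_sum_single α]
  exact Submodule.sum_mem _ fun P _ => key P _

-- Infinite descent: reducing a relation over `k[y]` modulo `y` kills all constant terms, because
-- the `b j` are independent modulo `y M`; dividing by `y` then lowers the degrees.
open Polynomial in
theorem eq_zero_of_sum_aeval_mul_eq_zero {n : ℕ} {M : Submodule k F} {y : F} {b : Fin n → F}
    (hy : y ≠ 0) (hM : ∀ (p : k[X]) j, aeval y p * b j ∈ M)
    (hb : ∀ c : Fin n → k, (∃ x ∈ M, ∑ j, c j • b j = y * x) → c = 0) (d : ℕ) (p : Fin n → k[X])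
    (hd : ∀ j, (p j).natDegree < d) (hp : ∑ j, aeval y (p j) * b j = 0) : p = 0 := by
  induction d generalizing p with
  | zero => ext j; exact absurd (hd j) (by simp)
  | succ d ih =>
    have hdec : ∀ j, aeval y (p j) * b j =
        y * (aeval y (p j).divX * b j) + (p j).coeff 0 • b j := by
      intro j
      conv_lhs => rw [← divX_mul_X_add (p j)]
      simp only [map_add, map_mul, aeval_X, aeval_C, Algebra.smul_def]
      ring
    have hsum : y * ∑ j, aeval y (p j).divX * b j + ∑ j, (p j).coeff 0 • b j = 0 := by
      rw [← hp, Finset.sum_congr rfl fun j _ => hdec j, Finset.sum_add_distrib, Finset.mul_sum]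
    have hc : (fun j => (p j).coeff 0) = 0 := by
      refine hb _ ⟨-∑ j, aeval y (p j).divX * b j,
        M.neg_mem (M.sum_mem fun j _ => hM _ _), ?_⟩
      linear_combination hsum
    have hc' : ∀ j, (p j).coeff 0 = 0 := fun j => congrFun hc j
    simp only [hc', zero_smul, Finset.sum_const_zero, add_zero, mul_eq_zero, hy, false_or] at hsum
    by_cases hd0 : ∃ j, (p j).natDegree ≠ 0
    · have hdpos : 0 < d := by
        obtain ⟨j, hj⟩ := hd0
        have := hd j
        omega
      have h0 := ih (fun j => (p j).divX) (fun j => by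
        rw [natDegree_divX_eq_natDegree_tsub_one]
        have := hd j
        omega) hsum
      funext j
      have h1 : (p j).divX = 0 := congrFun h0 j
      rw [← divX_mul_X_add (p j), h1, hc' j]
      simp
    · push Not at hd0
      funext j
      rw [eq_C_of_natDegree_eq_zero (hd0 j), hc' j]
      simp

open IntermediateField.algebraAdjoinAdjoin in
open Polynomial in
theorem linearIndependent_adjoin_of_residues {n : ℕ} {M : Submodule k F} {y : F} {b : Fin n → F}
    (hy : y ≠ 0) (hM : ∀ (p : k[X]) j, aeval y p * b j ∈ M)
    (hb : ∀ c : Fin n → k, (∃ x ∈ M, ∑ j, c j • b j = y * x) → c = 0) :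
    LinearIndependent (IntermediateField.adjoin k {y}) b := by
  rw [← LinearIndependent.iff_fractionRing (Algebra.adjoin k {y})]
  rw [Fintype.linearIndependent_iff]
  intro g hg
  have hmem : ∀ j, ∃ p : k[X], aeval y p = (g j : F) := by
    intro j
    exact (Algebra.adjoin_singleton_eq_range_aeval k y).le (g j).2
  choose p hp using hmem
  have : p = 0 := by
    refine eq_zero_of_sum_aeval_mul_eq_zero hy hM hb
      (Finset.univ.sup (fun j => (p j).natDegree) + 1) p (fun j => ?_) ?_
    · exact Nat.lt_succ_of_le (Finset.le_sup (f := fun j => (p j).natDegree) (Finset.mem_univ j))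
    · rw [← hg]
      exact Finset.sum_congr rfl fun j _ => by rw [hp]; rfl
  intro j
  ext
  rw [← hp j, this]
  simp

/-- The number of zeros of a function, counted with multiplicities. -/
theorem Independent.sum_zeros_le [Finite ι] (h : 𝓥.Independent) (hf : 𝓥.FiniteResidue) {y : F}
    (e : ι →₀ ℕ) (hy : ∀ P, 𝓥.v P y = exp (-(e P : ℤ)))
    [FiniteDimensional (IntermediateField.adjoin k {y}) F] :
    𝓥.effDegree e ≤ Module.finrank (IntermediateField.adjoin k {y}) F := by
  rcases isEmpty_or_nonempty ι with hι | hι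
  · rw [Subsingleton.elim e 0]; simp [effDegree]
  have hy0 : y ≠ 0 := by
    rintro rfl
    have := hy (Classical.arbitrary ι)
    rw [map_zero] at this
    exact exp_ne_zero this.symm
  have hlen := effDegree_eq hf (fun P => -(e P : ℤ)) e
  -- By weak approximation the part modulo `F` vanishes, so `deg e = dim B / A`. Here `B` consists
  -- of the functions regular at the given places and `y B ⊆ A`; lifts to `B` of a basis of `B / A`
  -- will be independent over `k(y)`.
  rw [h.box_sup_diag, h.box_sup_diag, relLength_eq_zero.2 le_rfl, add_zero] at hlen
  simp only [neg_add_cancel] at hlen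
  set A := 𝓥.sections (fun P => -(e P : ℤ)) with hA
  set B := 𝓥.sections (fun _ => 0) with hB
  have hfl : IsFiniteLength k (B ⧸ A.submoduleOf B) := by
    rw [← Module.length_ne_top_iff]
    change relLength A B ≠ ⊤
    rw [← hlen]; exact ENat.natCast_ne_top _
  have hfin : Module.Finite k (B ⧸ A.submoduleOf B) := by
    have := (isFiniteLength_iff_isNoetherian_isArtinian.1 hfl).1
    infer_instance
  have hrank : Module.finrank k (B ⧸ A.submoduleOf B) = 𝓥.effDegree e := by
    have h1 := Module.length_eq_finrank k (B ⧸ A.submoduleOf B)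
    change relLength A B = _ at h1
    rw [← hlen] at h1
    exact_mod_cast h1.symm
  let β := Module.finBasis k (B ⧸ A.submoduleOf B)
  choose b hb using fun j => Submodule.Quotient.mk_surjective _ (β j)
  have hyB : ∀ P, 𝓥.v P y ≤ 1 := by
    intro P; rw [hy P, ← exp_zero]; exact exp_le_exp.2 (by simp)
  have hli : LinearIndependent (IntermediateField.adjoin k {y}) (fun j => (b j : F)) := by
    refine linearIndependent_adjoin_of_residues (M := B) hy0 ?_ ?_
    · intro p j
      induction p using Polynomial.induction_on' with
      | add p q hp hq => rw [map_add, add_mul]; exact B.add_mem hp hq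
      | monomial i c =>
        rw [Polynomial.aeval_monomial, ← Algebra.smul_def, smul_mul_assoc]
        refine B.smul_mem c fun P => ?_
        simp only [diag_apply, map_mul, map_pow]
        exact mul_le_of_le_one_of_le (pow_le_one₀ zero_le (hyB P)) ((b j).2 P)
    · rintro c ⟨x, hx, hcx⟩
      have h1 : ∑ j, c j • b j ∈ A.submoduleOf B := by
        change B.subtype (∑ j, c j • b j) ∈ A
        simp only [map_sum, map_smul, Submodule.subtype_apply]
        rw [hcx]
        intro P
        simp only [diag_apply, map_mul, hy P]
        exact mul_le_of_le_one_right' (hx P)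
      rw [← Submodule.Quotient.mk_eq_zero, ← Submodule.mkQ_apply, map_sum] at h1
      simp only [map_smul, Submodule.mkQ_apply, hb] at h1
      funext j
      exact Fintype.linearIndependent_iff.1 β.linearIndependent c h1 j
  have := hli.fintype_card_le_finrank
  rwa [Fintype.card_fin, hrank] at this

end PlaceFamily

theorem Valuation.le_one_of_isIntegral {A F Γ : Type*} [CommRing A] [Field F] [Algebra A F]
    [LinearOrderedCommGroupWithZero Γ] (v : Valuation F Γ) (h : ∀ a, v (algebraMap A F a) ≤ 1)
    {u : F} (hu : IsIntegral A u) : v u ≤ 1 := by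
  obtain ⟨p, hp, hpu⟩ := hu
  let φ : A →+* v.integer := (algebraMap A F).codRestrict v.integer h
  refine (Valuation.integer.integers v).mem_of_integral ⟨p.map φ, hp.map φ, ?_⟩
  rw [Polynomial.eval₂_map]
  exact hpu

theorem IntermediateField.adjoin_inv_singleton {k F : Type*} [Field k] [Field F] [Algebra k F]
    (x : F) : IntermediateField.adjoin k {x⁻¹} = IntermediateField.adjoin k {x} := by
  apply le_antisymm
  · rw [IntermediateField.adjoin_simple_le_iff]
    exact inv_mem (IntermediateField.mem_adjoin_simple_self k x)
  · rw [IntermediateField.adjoin_simple_le_iff]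
    exact inv_mem_iff.1 (IntermediateField.mem_adjoin_simple_self k x⁻¹)

/-! ### Complete families: poles, constants and finiteness of `ℓ(D)`. -/

namespace PlaceFamily

variable {k F ι : Type*} [Field k] [Field F] [Algebra k F] {𝓥 : PlaceFamily k F ι}

/-- The subfamily of the places in a finite set. -/
def restrict (𝓥 : PlaceFamily k F ι) (S : Finset ι) : PlaceFamily k F S where
  v P := 𝓥.v P
  map_const P := 𝓥.map_const P
  surjective P := 𝓥.surjective P

/-- The places of a function field of one variable `F / k`, all of them being present. -/
structure IsComplete (𝓥 : PlaceFamily k F ι) : Prop where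
  finiteResidue : 𝓥.FiniteResidue
  independent : 𝓥.Independent
  finite_adjoin : ∀ x : F, Transcendental k x →
    FiniteDimensional (IntermediateField.adjoin k {x}) F
  exists_pole : ∀ x : F, Transcendental k x → ∃ P, 1 < 𝓥.v P x

theorem le_one_of_isAlgebraic {x : F} (hx : IsAlgebraic k x) (P : ι) : 𝓥.v P x ≤ 1 :=
  (𝓥.v P).le_one_of_isIntegral (𝓥.map_const P) hx.isIntegral

theorem eq_one_of_isAlgebraic {x : F} (hx : IsAlgebraic k x) (h0 : x ≠ 0) (P : ι) :
    𝓥.v P x = 1 := by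
  apply le_antisymm (le_one_of_isAlgebraic hx P)
  have := 𝓥.le_one_of_isAlgebraic hx.inv P
  rwa [map_inv₀, inv_le_one₀ (by simpa [zero_lt_iff] using h0)] at this

/-- The order of the pole of a function. -/
noncomputable def poleOrder (𝓥 : PlaceFamily k F ι) (x : F) (P : ι) : ℕ := (log (𝓥.v P x)).toNat

theorem poleOrder_eq_zero {x : F} {P : ι} : 𝓥.poleOrder x P = 0 ↔ 𝓥.v P x ≤ 1 := by
  rcases eq_or_ne x 0 with rfl | hx
  · simp [poleOrder]
  have hv : 𝓥.v P x ≠ 0 := by simpa using hx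
  rw [poleOrder, Int.toNat_eq_zero, log_le_iff_le_exp hv, exp_zero]

theorem le_exp_poleOrder (x : F) (P : ι) : 𝓥.v P x ≤ exp (𝓥.poleOrder x P : ℤ) := by
  rcases eq_or_ne x 0 with rfl | hx
  · simp
  have hv : 𝓥.v P x ≠ 0 := by simpa using hx
  rw [← log_le_iff_le_exp hv]
  exact Int.self_le_toNat _

theorem eq_exp_poleOrder {x : F} {P : ι} (h : 1 < 𝓥.v P x) :
    𝓥.v P x = exp (𝓥.poleOrder x P : ℤ) := by
  have hv : 𝓥.v P x ≠ 0 := (zero_lt_one.trans h).ne'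
  have : 0 ≤ log (𝓥.v P x) := by
    rw [← log_one]; exact (log_le_log one_ne_zero hv).2 h.le
  rw [poleOrder, Int.toNat_of_nonneg this, exp_log hv]

theorem resDegree_pos (hf : 𝓥.FiniteResidue) (P : ι) : 0 < 𝓥.resDegree P := by
  rw [Nat.pos_iff_ne_zero, resDegree, Ne, ENat.toNat_eq_zero, not_or]
  refine ⟨fun h => ?_, hf P⟩
  have h1 : (1 : F) ∈ 𝓥.localIdeal P 0 := by simp
  have h2 := relLength_eq_zero.1 h h1
  rw [mem_localIdeal, map_one, ← exp_zero, exp_le_exp] at h2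
  omega

namespace IsComplete

variable (h : 𝓥.IsComplete)
include h

/-- The poles of `x` are the zeros of `x⁻¹`, and `k(x⁻¹) = k(x)`. Weak approximation needs finitely
many places, hence the set `S`; finiteness of the set of poles is deduced from this bound. -/
theorem sum_poles_le {x : F} (hx : Transcendental k x) (S : Finset ι) (hS : ∀ P ∈ S, 1 < 𝓥.v P x) :
    ∑ P ∈ S, 𝓥.poleOrder x P * 𝓥.resDegree P ≤
      Module.finrank (IntermediateField.adjoin k {x}) F := by
  have hfd := h.finite_adjoin x hx
  rw [← IntermediateField.adjoin_inv_singleton] at hfd ⊢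
  have h1 := Independent.sum_zeros_le (𝓥 := 𝓥.restrict S) (y := x⁻¹)
    (fun P Q hPQ => h.independent P Q fun h => hPQ (Subtype.ext h)) (fun P => h.finiteResidue P)
    (Finsupp.equivFunOnFinite.symm fun P => 𝓥.poleOrder x P) (fun P => by
      change 𝓥.v P x⁻¹ = _
      rw [map_inv₀, eq_exp_poleOrder (hS P P.2), ← exp_neg]
      rfl)
  refine le_trans (le_of_eq ?_) h1
  rw [effDegree, Finsupp.sum_fintype _ _ (by simp)]
  exact (Finset.sum_coe_sort S _).symm

theorem finite_poles (x : F) : {P | 1 < 𝓥.v P x}.Finite := by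
  by_cases hx : Transcendental k x
  · by_contra hinf
    obtain ⟨S, hS, hcard⟩ := Set.Infinite.exists_subset_card_eq hinf
      (Module.finrank (IntermediateField.adjoin k {x}) F + 1)
    have h1 := h.sum_poles_le hx S (fun P hP => hS hP)
    have h2 : S.card ≤ ∑ P ∈ S, 𝓥.poleOrder x P * 𝓥.resDegree P := by
      rw [Finset.card_eq_sum_ones]
      refine Finset.sum_le_sum fun P hP => Nat.mul_pos ?_ (resDegree_pos h.finiteResidue P)
      rw [Nat.pos_iff_ne_zero, Ne, poleOrder_eq_zero, not_le]
      exact hS hP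
    omega
  · convert Set.finite_empty
    ext P
    simpa using le_one_of_isAlgebraic (not_not.1 hx) P

theorem finite_support_poleOrder (x : F) : (Function.support (𝓥.poleOrder x)).Finite := by
  refine (h.finite_poles x).subset fun P hP => ?_
  rw [Function.mem_support, Ne, poleOrder_eq_zero, not_le] at hP
  exact hP

/-- The divisor of poles of a function. -/
noncomputable def poleDiv (x : F) : ι →₀ ℕ :=
  Finsupp.ofSupportFinite (𝓥.poleOrder x) (h.finite_support_poleOrder x)

@[simp]
theorem poleDiv_apply (x : F) (P : ι) : h.poleDiv x P = 𝓥.poleOrder x P := rfl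

theorem effDegree_poleDiv_le {x : F} (hx : Transcendental k x) :
    𝓥.effDegree (h.poleDiv x) ≤ Module.finrank (IntermediateField.adjoin k {x}) F := by
  refine h.sum_poles_le hx _ fun P hP => ?_
  rw [Finsupp.mem_support_iff, poleDiv_apply, Ne, poleOrder_eq_zero, not_le] at hP
  exact hP

theorem isAlgebraic_of_mem_sections_zero {x : F} (hx : x ∈ 𝓥.sections 0) : IsAlgebraic k x := by
  by_contra hx'
  obtain ⟨P, hP⟩ := h.exists_pole x hx'
  exact absurd (hx P) (not_le.2 hP)

theorem mem_sections_zero_iff {x : F} : x ∈ 𝓥.sections 0 ↔ IsAlgebraic k x :=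
  ⟨h.isAlgebraic_of_mem_sections_zero, fun hx P => le_one_of_isAlgebraic hx P⟩

/-- Nonzero constants have value one at `P`, so they embed into the residue field there. -/
theorem length_sections_zero_le (P : ι) :
    Module.length k (𝓥.sections 0) ≤ 𝓥.resDegree P := by
  have h1 : 𝓥.localIdeal P (-1) ⊓ 𝓥.sections 0 = ⊥ := by
    rw [eq_bot_iff]
    rintro x ⟨hx, hx0⟩
    by_contra hne
    have := eq_one_of_isAlgebraic (𝓥 := 𝓥) (h.isAlgebraic_of_mem_sections_zero hx0) hne P
    have hx' : 𝓥.v P x ≤ exp (-1) := hx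
    rw [this, ← exp_zero, exp_le_exp] at hx'
    omega
  rw [← relLength_bot, ← h1, relLength_inf_right, resDegree, ENat.natCast_toNat (h.finiteResidue P)]
  exact relLength_le_of_le fun x hx => hx P

end IsComplete

/-- The degree of a divisor. -/
noncomputable def degree (𝓥 : PlaceFamily k F ι) (D : ι →₀ ℤ) : ℤ :=
  D.sum fun P n => n * 𝓥.resDegree P

@[simp]
theorem degree_zero : 𝓥.degree 0 = 0 := by simp [degree]

theorem degree_add (D D' : ι →₀ ℤ) : 𝓥.degree (D + D') = 𝓥.degree D + 𝓥.degree D' :=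
  Finsupp.sum_add_index' (by simp) (by intros; ring)

theorem degree_sub (D D' : ι →₀ ℤ) : 𝓥.degree (D - D') = 𝓥.degree D - 𝓥.degree D' := by
  have := 𝓥.degree_add (D - D') D'
  rw [sub_add_cancel] at this
  omega

theorem degree_neg (D : ι →₀ ℤ) : 𝓥.degree (-D) = -𝓥.degree D := by
  rw [← zero_sub, degree_sub, degree_zero, zero_sub]

theorem degree_nsmul (m : ℕ) (D : ι →₀ ℤ) : 𝓥.degree (m • D) = m * 𝓥.degree D := by
  induction m with
  | zero => simp
  | succ m ih => rw [succ_nsmul, degree_add, ih]; push_cast; ring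

/-- An effective divisor as a divisor. -/
noncomputable def ofNat : (ι →₀ ℕ) →+ (ι →₀ ℤ) := Finsupp.mapRange.addMonoidHom (Nat.castAddMonoidHom ℤ)

@[simp]
theorem ofNat_apply (E : ι →₀ ℕ) (P : ι) : ofNat E P = E P := rfl

theorem degree_ofNat (E : ι →₀ ℕ) : 𝓥.degree (ofNat E) = 𝓥.effDegree E := by
  rw [degree, effDegree, ofNat, Finsupp.mapRange.addMonoidHom_apply,
    Finsupp.sum_mapRange_index (by simp), Finsupp.sum, Finsupp.sum]
  push_cast
  rfl

theorem exists_eq_add_ofNat {D D' : ι →₀ ℤ} (h : D ≤ D') : ∃ E, D' = D + ofNat E := by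
  refine ⟨(D' - D).mapRange Int.toNat rfl, ?_⟩
  ext P
  have := h P
  simp
  omega

theorem degree_mono {D D' : ι →₀ ℤ} (h : D ≤ D') : 𝓥.degree D ≤ 𝓥.degree D' := by
  obtain ⟨E, rfl⟩ := exists_eq_add_ofNat h
  rw [degree_add, degree_ofNat]
  omega

theorem exists_le_ofNat (D : ι →₀ ℤ) : ∃ E, D ≤ ofNat E := by
  refine ⟨D.mapRange Int.toNat rfl, fun P => ?_⟩
  simp

/-- The defect `deg D - ℓ(D)`. -/
noncomputable def defect (𝓥 : PlaceFamily k F ι) (D : ι →₀ ℤ) : ℤ :=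
  𝓥.degree D - Module.finrank k (𝓥.sections D)

namespace IsComplete

variable [Nonempty ι] (h : 𝓥.IsComplete)
include h

theorem length_sections_ne_top (D : ι →₀ ℤ) : Module.length k (𝓥.sections D) ≠ ⊤ := by
  obtain ⟨E, hE⟩ := exists_le_ofNat D
  have h0 := h.length_sections_zero_le (Classical.arbitrary ι)
  have h1 := effDegree_eq h.finiteResidue 0 E
  have h2 : 𝓥.sections D ≤ 𝓥.sections fun P => (0 : ι → ℤ) P + E P :=
    sections_mono fun P => by simpa using hE P
  have h3 : 𝓥.sections 0 ≤ 𝓥.sections fun P => (0 : ι → ℤ) P + E P :=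
    sections_mono fun P => by simp
  have h4 := relLength_trans bot_le h3
  have h5 := relLength_le_of_le (A := ⊥) h2
  rw [relLength_bot] at h5
  refine ne_top_of_le_ne_top ?_ h5
  rw [h4, relLength_bot]
  refine WithTop.add_ne_top.2 ⟨ne_top_of_le_ne_top (ENat.natCast_ne_top _) h0, ?_⟩
  exact ne_top_of_le_ne_top (ENat.natCast_ne_top _) (le_of_le_of_eq le_self_add h1.symm)

/-- Ensures that the `finrank` in `defect` is a true dimension and not the default value `0`. -/
theorem finite_sections (D : ι →₀ ℤ) : Module.Finite k (𝓥.sections D) := by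
  have := (isFiniteLength_iff_isNoetherian_isArtinian.1
    (Module.length_ne_top_iff.1 (h.length_sections_ne_top D))).1
  infer_instance

theorem length_sections (D : ι →₀ ℤ) :
    Module.length k (𝓥.sections D) = Module.finrank k (𝓥.sections D) := by
  have := h.finite_sections D
  exact Module.length_eq_finrank k _

/-- Rewrites `effDegree_eq` through defects: their growth measures how much `𝔸(D) + F` grows, so the
defect is monotone, and where it stays constant `𝔸(D) + F` does too. -/
theorem exists_relLength_eq {D D' : ι →₀ ℤ} (hD : D ≤ D') : ∃ r : ℕ,
    relLength (𝓥.box D ⊔ LinearMap.range (diag k F ι)) (𝓥.box D' ⊔ LinearMap.range (diag k F ι)) = r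
      ∧ (r : ℤ) = 𝓥.defect D' - 𝓥.defect D := by
  obtain ⟨E, rfl⟩ := exists_eq_add_ofNat hD
  have h1 := effDegree_eq h.finiteResidue D E
  have he : (fun P => D P + (E P : ℤ)) = ⇑(D + ofNat E) := by ext P; simp
  rw [he] at h1
  have h2 : relLength (𝓥.sections D) (𝓥.sections ⇑(D + ofNat E)) ≠ ⊤ :=
    ne_top_of_le_ne_top (ENat.natCast_ne_top _) (le_of_le_of_eq le_self_add h1.symm)
  have h3 : relLength (𝓥.box D ⊔ LinearMap.range (diag k F ι))
      (𝓥.box ⇑(D + ofNat E) ⊔ LinearMap.range (diag k F ι)) ≠ ⊤ :=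
    ne_top_of_le_ne_top (ENat.natCast_ne_top _) (le_of_le_of_eq le_add_self h1.symm)
  have h4 := relLength_trans bot_le (sections_mono (𝓥 := 𝓥) hD)
  rw [relLength_bot, relLength_bot, h.length_sections, h.length_sections] at h4
  obtain ⟨a, ha⟩ := ENat.ne_top_iff_exists.1 h2
  obtain ⟨r, hr⟩ := ENat.ne_top_iff_exists.1 h3
  refine ⟨r, hr.symm, ?_⟩
  rw [← ha] at h4
  rw [← ha, ← hr] at h1
  have h1' : 𝓥.effDegree E = a + r := by exact_mod_cast h1
  have h4' : Module.finrank k (𝓥.sections ⇑(D + ofNat E)) =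
    Module.finrank k (𝓥.sections D) + a := by exact_mod_cast h4
  rw [defect, defect, degree_add, degree_ofNat, h4', h1']
  push_cast
  ring

theorem defect_mono {D D' : ι →₀ ℤ} (hD : D ≤ D') : 𝓥.defect D ≤ 𝓥.defect D' := by
  obtain ⟨r, -, hr⟩ := h.exists_relLength_eq hD
  omega

end IsComplete

end PlaceFamily

/-! ### Principal divisors have degree zero; Riemann's inequality. -/

namespace PlaceFamily

variable {k F ι : Type*} [Field k] [Field F] [Algebra k F] {𝓥 : PlaceFamily k F ι}

namespace IsComplete

variable (h : 𝓥.IsComplete)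
include h

-- A basis of `F` over `k(x)` can be chosen integral over `k[x]`, so that its poles lie among those
-- of `x` and are bounded by `m₀` times the pole divisor. The products `x ^ i * b j` with `i ≤ m`
-- are then independent sections.
open IntermediateField.algebraAdjoinAdjoin in
theorem exists_forall_finrank_mul_le [Nonempty ι] {x : F} (hx : Transcendental k x) :
    ∃ m₀ : ℕ, ∀ m : ℕ, Module.finrank (IntermediateField.adjoin k {x}) F * (m + 1) ≤
      Module.finrank k (𝓥.sections ⇑((m + m₀) • ofNat (h.poleDiv x))) := by
  have hfd := h.finite_adjoin x hx
  obtain ⟨s, b, hb⟩ := FiniteDimensional.exists_is_basis_integral (Algebra.adjoin k {x})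
    (IntermediateField.adjoin k {x}) F
  have hint : ∀ P j, 𝓥.v P x ≤ 1 → 𝓥.v P (b j) ≤ 1 := by
    intro P j hP
    refine (𝓥.v P).le_one_of_isIntegral (A := Algebra.adjoin k {x}) (fun a => ?_) (hb j)
    obtain ⟨a, ha⟩ := a
    change 𝓥.v P a ≤ 1
    induction ha using Algebra.adjoin_induction with
    | mem y hy => rw [Set.mem_singleton_iff.1 hy]; exact hP
    | algebraMap c => exact 𝓥.map_const P c
    | add y z _ _ hy hz => exact (𝓥.v P).map_add_le hy hz
    | mul y z _ _ hy hz => rw [map_mul]; exact mul_le_one' hy hz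
  obtain ⟨m₀, hm₀⟩ : ∃ m₀ : ℕ, ∀ P j, 𝓥.poleOrder (b j) P ≤ m₀ * 𝓥.poleOrder x P := by
    refine ⟨∑ j, ∑ P ∈ (h.poleDiv x).support, 𝓥.poleOrder (b j) P, fun P j => ?_⟩
    by_cases hP : 𝓥.v P x ≤ 1
    · rw [poleOrder_eq_zero.2 (hint P j hP)]; exact Nat.zero_le _
    · have hP' : P ∈ (h.poleDiv x).support := by
        rw [Finsupp.mem_support_iff, poleDiv_apply, Ne, poleOrder_eq_zero]; exact hP
      have h1 : 0 < 𝓥.poleOrder x P := by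
        rw [Nat.pos_iff_ne_zero, Ne, poleOrder_eq_zero]; exact hP
      have h2 : 𝓥.poleOrder (b j) P ≤ ∑ P ∈ (h.poleDiv x).support, 𝓥.poleOrder (b j) P :=
        Finset.single_le_sum (f := fun P => 𝓥.poleOrder (b j) P) (fun _ _ => Nat.zero_le _) hP'
      have h3 : ∑ P ∈ (h.poleDiv x).support, 𝓥.poleOrder (b j) P ≤
          ∑ j, ∑ P ∈ (h.poleDiv x).support, 𝓥.poleOrder (b j) P :=
        Finset.single_le_sum (f := fun j => ∑ P ∈ (h.poleDiv x).support, 𝓥.poleOrder (b j) P)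
          (fun _ _ => Nat.zero_le _) (Finset.mem_univ j)
      exact (h2.trans h3).trans (Nat.le_mul_of_pos_right _ h1)
  refine ⟨m₀, fun m => ?_⟩
  let a : Fin (m + 1) → IntermediateField.adjoin k {x} :=
    fun i => ⟨x, IntermediateField.mem_adjoin_simple_self k x⟩ ^ (i : ℕ)
  have ha : LinearIndependent k a := by
    have h1 : LinearIndependent k (fun i : ℕ => x ^ i) := by
      have := (Polynomial.basisMonomials k).linearIndependent.map' (Polynomial.aeval x).toLinearMap
        (LinearMap.ker_eq_bot.2 (transcendental_iff_injective.1 hx))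
      have e : (fun i : ℕ => x ^ i) =
          (Polynomial.aeval x).toLinearMap ∘ (Polynomial.basisMonomials k) := by
        ext i
        simp
      rw [e]
      exact this
    have h2 := h1.comp (fun i : Fin (m + 1) => (i : ℕ)) Fin.val_injective
    refine LinearIndependent.of_comp (IntermediateField.adjoin k {x}).val.toLinearMap ?_
    convert h2 using 1
    ext i
    simp [a]
  have hab := linearIndependent_smul ha b.linearIndependent
  have hmem : ∀ p : Fin (m + 1) × s, a p.1 • b p.2 ∈
      𝓥.sections ⇑((m + m₀) • ofNat (h.poleDiv x)) := by
    rintro ⟨i, j⟩ P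
    have e : (a i • b j : F) = x ^ (i : ℕ) * b j := rfl
    simp only [diag_apply, e, map_mul, map_pow]
    have hi : (i : ℕ) ≤ m := Nat.lt_succ_iff.1 i.2
    calc 𝓥.v P x ^ (i : ℕ) * 𝓥.v P (b j)
        ≤ exp (𝓥.poleOrder x P : ℤ) ^ (i : ℕ) * exp (𝓥.poleOrder (b j) P : ℤ) :=
          mul_le_mul' (pow_le_pow_left₀ zero_le (le_exp_poleOrder _ _) _) (le_exp_poleOrder _ _)
      _ = exp ((i : ℕ) • (𝓥.poleOrder x P : ℤ) + 𝓥.poleOrder (b j) P) := by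
          rw [exp_add, exp_nsmul]
      _ ≤ _ := by
          rw [exp_le_exp]
          have := hm₀ P j
          simp only [Finsupp.coe_smul, Pi.smul_apply, ofNat_apply, poleDiv_apply,
            nsmul_eq_mul]
          norm_cast
          nlinarith [Nat.mul_le_mul_right (𝓥.poleOrder x P) hi]
  have hli : LinearIndependent k (fun p : Fin (m + 1) × s =>
      (⟨a p.1 • b p.2, hmem p⟩ : 𝓥.sections ⇑((m + m₀) • ofNat (h.poleDiv x)))) := by
    refine LinearIndependent.of_comp (Submodule.subtype _) ?_
    exact hab
  have := h.finite_sections ((m + m₀) • ofNat (h.poleDiv x))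
  have hcard := hli.fintype_card_le_finrank
  rw [Fintype.card_prod, Fintype.card_fin] at hcard
  rw [Module.finrank_eq_card_basis b, mul_comm]
  exact hcard

theorem effDegree_poleDiv [Nonempty ι] {x : F} (hx : Transcendental k x) :
    𝓥.effDegree (h.poleDiv x) = Module.finrank (IntermediateField.adjoin k {x}) F := by
  refine le_antisymm (h.effDegree_poleDiv_le hx) ?_
  by_contra! hlt
  obtain ⟨m₀, hm₀⟩ := h.exists_forall_finrank_mul_le hx
  set n := Module.finrank (IntermediateField.adjoin k {x}) F
  set d := 𝓥.effDegree (h.poleDiv x) with hd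
  set l := Module.finrank k (𝓥.sections 0)
  -- Monotonicity of the defect bounds sections of `(m + m₀)` times the pole divisor by `(m + m₀) *
  -- d + l`, against the lower bound `n * (m + 1)`. If `d < n`, the value `m = m₀ * d + l` already
  -- gives a contradiction.
  have h1 := hm₀ (m₀ * d + l)
  have h2 := h.defect_mono (D := 0) (D' := (m₀ * d + l + m₀) • ofNat (h.poleDiv x)) (fun P => by
    simp only [Finsupp.coe_zero, Pi.zero_apply, Finsupp.coe_smul, Pi.smul_apply, ofNat_apply,
      nsmul_eq_mul]
    positivity)
  rw [defect, defect, degree_nsmul, degree_ofNat, degree_zero] at h2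
  change 0 - (l : ℤ) ≤ _ at h2
  rw [← hd] at h2
  have h3 : (n : ℤ) * (m₀ * d + l + 1) ≤ (m₀ * d + l + m₀) * d + l := by
    have : ((n * (m₀ * d + l + 1) : ℕ) : ℤ) ≤ _ := Int.ofNat_le.2 h1
    push_cast at this h2
    linarith
  have h4 : (d : ℤ) + 1 ≤ n := by exact_mod_cast hlt
  have h5 : (0 : ℤ) ≤ m₀ * d + l + 1 := by positivity
  nlinarith

/-- The divisor of poles minus the divisor of zeros of a function. -/
noncomputable def prin (f : F) : ι →₀ ℤ := ofNat (h.poleDiv f) - ofNat (h.poleDiv f⁻¹)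

theorem prin_apply (f : F) (P : ι) : h.prin f P = log (𝓥.v P f) := by
  simp only [prin, Finsupp.coe_sub, Pi.sub_apply, ofNat_apply, poleDiv_apply, poleOrder, map_inv₀,
    log_inv]
  omega

theorem exp_prin {f : F} (hf : f ≠ 0) (P : ι) : exp (h.prin f P) = 𝓥.v P f := by
  rw [prin_apply, exp_log (by simpa using hf)]

/-- For transcendental `f` the numbers of poles and of zeros both equal `[F : k(f)]`, as `k(f⁻¹) =
k(f)`; an algebraic `f` has neither, and `prin 0 = 0` since `log 0 = 0`. -/
theorem degree_prin (f : F) : 𝓥.degree (h.prin f) = 0 := by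
  by_cases hf : Transcendental k f
  · have : Nonempty ι := (h.exists_pole f hf).nonempty
    have hf' : Transcendental k f⁻¹ := fun ha => hf (by simpa using ha.inv)
    rw [prin, degree_sub, degree_ofNat, degree_ofNat, h.effDegree_poleDiv hf,
      h.effDegree_poleDiv hf', IntermediateField.adjoin_inv_singleton, sub_self]
  · have : h.prin f = 0 := by
      ext P
      rw [prin_apply]
      rcases eq_or_ne f 0 with rfl | h0
      · simp
      · simp [eq_one_of_isAlgebraic (𝓥 := 𝓥) (not_not.1 hf) h0 P]
    rw [this, degree_zero]

theorem mul_mem_iff {f : F} (hf : f ≠ 0) (D : ι →₀ ℤ) (P : ι) (x : F) :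
    𝓥.v P (f * x) ≤ exp ((D + h.prin f) P) ↔ 𝓥.v P x ≤ exp (D P) := by
  have h0 : 0 < 𝓥.v P f := by simpa [zero_lt_iff] using hf
  rw [Finsupp.add_apply, exp_add, h.exp_prin hf, map_mul, mul_comm, mul_le_mul_iff_left₀ h0]

theorem finrank_sections_add_prin {f : F} (hf : f ≠ 0) (D : ι →₀ ℤ) :
    Module.finrank k (𝓥.sections ⇑(D + h.prin f)) = Module.finrank k (𝓥.sections D) := by
  have hinj : Function.Injective (LinearMap.mulLeft k f) := mul_right_injective₀ hf
  have : 𝓥.sections ⇑(D + h.prin f) = (𝓥.sections D).map (LinearMap.mulLeft k f) := by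
    ext x
    constructor
    · intro hx
      refine ⟨f⁻¹ * x, fun P => ?_, by simp [hf]⟩
      rw [← h.mul_mem_iff hf]
      simpa [hf] using hx P
    · rintro ⟨y, hy, rfl⟩ P
      exact (h.mul_mem_iff hf D P y).2 (hy P)
  rw [this]
  exact (Submodule.equivMapOfInjective _ hinj _).finrank_eq.symm

theorem defect_add_prin {f : F} (hf : f ≠ 0) (D : ι →₀ ℤ) :
    𝓥.defect (D + h.prin f) = 𝓥.defect D := by
  rw [defect, defect, degree_add, h.degree_prin, h.finrank_sections_add_prin hf, add_zero]

omit h in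
theorem exists_transcendental [Nonempty ι] (𝓥 : PlaceFamily k F ι) :
    ∃ x : F, Transcendental k x := by
  obtain ⟨t, ht, hv⟩ := 𝓥.exists_eq_exp (Classical.arbitrary ι) 1
  refine ⟨t, fun ha => ?_⟩
  have := eq_one_of_isAlgebraic (𝓥 := 𝓥) ha ht (Classical.arbitrary ι)
  rw [hv, exp_eq_one] at this
  omega

/-- Riemann's inequality. -/
theorem exists_defect_le [Nonempty ι] : ∃ c, ∀ D, 𝓥.defect D ≤ c := by
  obtain ⟨x, hx⟩ := exists_transcendental 𝓥
  have hfd := h.finite_adjoin x hx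
  obtain ⟨m₀, hm₀⟩ := h.exists_forall_finrank_mul_le hx
  set B := ofNat (h.poleDiv x) with hB
  set n := Module.finrank (IntermediateField.adjoin k {x}) F with hn
  have hnpos : 0 < n := Module.finrank_pos
  have hdegB : 𝓥.degree B = n := by rw [degree_ofNat, h.effDegree_poleDiv hx]
  have hB0 : ∀ P, 0 ≤ B P := fun P => by simp [hB]
  have hmul : ∀ m : ℕ, 𝓥.defect (m • B) ≤ n * m₀ := by
    intro m
    have h1 : 𝓥.defect (m • B) ≤ 𝓥.defect ((m + m₀) • B) := by
      refine h.defect_mono fun P => ?_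
      simp only [Finsupp.coe_smul, Pi.smul_apply, nsmul_eq_mul]
      have := hB0 P
      push_cast
      nlinarith
    refine h1.trans ?_
    rw [defect, degree_nsmul, hdegB]
    have : ((n * (m + 1) : ℕ) : ℤ) ≤ _ := Int.ofNat_le.2 (hm₀ m)
    push_cast at this ⊢
    nlinarith
  refine ⟨n * m₀, fun D => ?_⟩
  obtain ⟨E, hE⟩ := exists_le_ofNat D
  -- So large that the bound on the defect forces a nonzero section `f` of `m B - E`. Then `D ≤ E ≤
  -- m B + prin f⁻¹`, and adding a principal divisor does not change the defect.
  set m := (𝓥.degree (ofNat E) + n * m₀ + 1).toNat with hm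
  have h1 : 𝓥.defect (m • B - ofNat E) ≤ n * m₀ := by
    refine le_trans (h.defect_mono fun P => ?_) (hmul m)
    simp
  have h2 : 0 < Module.finrank k (𝓥.sections ⇑(m • B - ofNat E)) := by
    rw [defect, degree_sub, degree_nsmul, hdegB] at h1
    have h3 : 𝓥.degree (ofNat E) + n * m₀ + 1 ≤ (m : ℤ) := Int.self_le_toNat _
    have h4 : (1 : ℤ) ≤ n := by exact_mod_cast hnpos
    have h5 : (m : ℤ) ≤ m * n := by nlinarith [(Nat.cast_nonneg m : (0 : ℤ) ≤ m)]
    refine Int.natCast_pos.1 ?_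
    linarith
  have := h.finite_sections (m • B - ofNat E)
  obtain ⟨⟨f, hf⟩, hf0⟩ := Module.finrank_pos_iff_exists_ne_zero.1 h2
  have hf0' : f ≠ 0 := fun h0 => hf0 (Subtype.ext h0)
  have h6 : D ≤ m • B + h.prin f⁻¹ := by
    intro P
    have h7 := hf P
    rw [diag_apply, ← log_le_iff_le_exp (by simpa using hf0')] at h7
    have h8 := hE P
    rw [Finsupp.add_apply, prin_apply, map_inv₀, log_inv]
    rw [Finsupp.sub_apply] at h7
    linarith
  refine (h.defect_mono h6).trans ?_
  rw [h.defect_add_prin (inv_ne_zero hf0')]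
  exact hmul m

end IsComplete

/-! ### Adeles and the index of speciality. -/

/-- The adeles: families of functions which are regular almost everywhere. -/
def adeles (𝓥 : PlaceFamily k F ι) : Submodule k (ι → F) where
  carrier := {α | ∀ᶠ P in Filter.cofinite, 𝓥.v P (α P) ≤ 1}
  zero_mem' := by simp
  add_mem' := fun {α β} ha hb => by
    change ∀ᶠ P in Filter.cofinite, 𝓥.v P ((α + β) P) ≤ 1
    filter_upwards [ha, hb] with P h₁ h₂ using (𝓥.v P).map_add_le h₁ h₂
  smul_mem' := fun c {α} ha => by
    change ∀ᶠ P in Filter.cofinite, 𝓥.v P ((c • α) P) ≤ 1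
    filter_upwards [ha] with P h₁ using (𝓥.map_smul_le P c _).trans h₁

theorem mem_adeles {α : ι → F} : α ∈ 𝓥.adeles ↔ ∀ᶠ P in Filter.cofinite, 𝓥.v P (α P) ≤ 1 :=
  Iff.rfl

theorem box_le_adeles (D : ι →₀ ℤ) : 𝓥.box D ≤ 𝓥.adeles := by
  intro α hα
  rw [mem_adeles, Filter.eventually_cofinite]
  refine D.hasFiniteSupport.subset fun P hP => ?_
  rw [Function.mem_support]
  intro h0
  have := hα P
  rw [h0, exp_zero] at this
  exact hP this

theorem exists_mem_box {α : ι → F} (hα : α ∈ 𝓥.adeles) : ∃ E : ι →₀ ℕ, α ∈ 𝓥.box (ofNat E) := by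
  rw [mem_adeles, Filter.eventually_cofinite] at hα
  refine ⟨Finsupp.ofSupportFinite (fun P => 𝓥.poleOrder (α P) P) (hα.subset fun P hP => ?_),
    fun P => le_exp_poleOrder _ _⟩
  rw [Function.mem_support, Ne, poleOrder_eq_zero] at hP
  exact hP

namespace IsComplete

variable (h : 𝓥.IsComplete)
include h

theorem diag_mem_adeles (f : F) : diag k F ι f ∈ 𝓥.adeles := by
  rw [mem_adeles, Filter.eventually_cofinite]
  simpa using h.finite_poles f

/-- The Riemann-Roch theorem with the index of speciality. -/
theorem exists_relLength_adeles [Nonempty ι] : ∃ M : ℤ, ∀ D : ι →₀ ℤ, ∃ i : ℕ,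
    relLength (𝓥.box D ⊔ LinearMap.range (diag k F ι)) 𝓥.adeles = i ∧
      (i : ℤ) = M - 𝓥.defect D := by
  obtain ⟨c, hc⟩ := h.exists_defect_le
  -- The defect attains its maximum `M` at some `D₀` and is constant above it. There `𝔸(D) + F` no
  -- longer grows, so it already contains every adele.
  obtain ⟨M, ⟨D₀, hD₀⟩, hM⟩ := Int.exists_greatest_of_bdd (P := fun z => ∃ D, 𝓥.defect D = z)
    ⟨c, by rintro _ ⟨D, rfl⟩; exact hc D⟩ ⟨_, 0, rfl⟩
  have key : ∀ D, D₀ ≤ D →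
      𝓥.adeles = 𝓥.box D ⊔ LinearMap.range (diag k F ι) ∧ 𝓥.defect D = M := by
    intro D hD
    have hdef : ∀ D', D₀ ≤ D' → 𝓥.defect D' = M := fun D' hD' =>
      le_antisymm (hM _ ⟨D', rfl⟩) (hD₀ ▸ h.defect_mono hD')
    refine ⟨le_antisymm ?_ (sup_le (box_le_adeles D) ?_), hdef D hD⟩
    · intro α hα
      obtain ⟨E, hE⟩ := exists_mem_box hα
      obtain ⟨E', hE'⟩ := exists_le_ofNat D
      have h1 : D ≤ ofNat (E + E') := fun P => by
        have := hE' P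
        simp only [ofNat_apply, Finsupp.coe_add, Pi.add_apply] at this ⊢
        push_cast
        omega
      obtain ⟨r, hr, hr'⟩ := h.exists_relLength_eq h1
      rw [hdef _ (hD.trans h1), hdef D hD, sub_self] at hr'
      have hr0 : r = 0 := by exact_mod_cast hr'
      rw [hr0, Nat.cast_zero, relLength_eq_zero] at hr
      refine hr (Submodule.mem_sup_left (𝓥.box_mono (fun P => ?_) hE))
      simp
    · rintro _ ⟨f, rfl⟩
      exact h.diag_mem_adeles f
  refine ⟨M, fun D => ?_⟩
  obtain ⟨E₁, hE₁⟩ := exists_le_ofNat (D₀ - D)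
  have h1 : D ≤ D + ofNat E₁ := fun P => by simp
  have h2 : D₀ ≤ D + ofNat E₁ := fun P => by
    have := hE₁ P
    simp only [Finsupp.coe_sub, Pi.sub_apply, ofNat_apply, Finsupp.coe_add, Pi.add_apply] at this ⊢
    omega
  obtain ⟨r, hr, hr'⟩ := h.exists_relLength_eq h1
  rw [(key _ h2).2] at hr'
  rw [(key _ h2).1]
  exact ⟨r, hr, hr'⟩

end IsComplete

end PlaceFamily

/-! ### Weil differentials and the degree of a canonical divisor. -/

namespace PlaceFamily

variable {k F ι : Type*} [Field k] [Field F] [Algebra k F] {𝓥 : PlaceFamily k F ι}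

namespace IsComplete

variable (h : 𝓥.IsComplete)
include h

theorem mul_mem_adeles (f : F) {α : ι → F} (hα : α ∈ 𝓥.adeles) :
    (fun P => f * α P) ∈ 𝓥.adeles := by
  obtain ⟨E, hE⟩ := exists_mem_box hα
  refine box_le_adeles (ofNat (E + h.poleDiv f)) fun P => ?_
  rw [map_mul, mul_comm, ofNat_apply, Finsupp.add_apply, Nat.cast_add, exp_add]
  exact mul_le_mul' (hE P) (le_exp_poleOrder f P)

/-- Multiplication of adeles by a rational function, as a bilinear map. -/
noncomputable def mulAdele : F →ₗ[k] 𝓥.adeles →ₗ[k] 𝓥.adeles :=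
  LinearMap.mk₂ k (fun f α => ⟨fun P => f * α.1 P, h.mul_mem_adeles f α.2⟩)
    (fun f g α => by ext P; exact add_mul _ _ _)
    (fun c f α => by ext P; exact smul_mul_assoc _ _ _)
    (fun f α β => by ext P; exact mul_add _ _ _)
    (fun c f α => by ext P; exact mul_smul_comm _ _ _)

@[simp]
theorem mulAdele_apply (f : F) (α : 𝓥.adeles) (P : ι) : (h.mulAdele f α).1 P = f * α.1 P := rfl

theorem mulAdele_mul (f g : F) (α : 𝓥.adeles) :
    h.mulAdele f (h.mulAdele g α) = h.mulAdele (f * g) α := by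
  ext P; simp [mul_assoc]

theorem mulAdele_one (α : 𝓥.adeles) : h.mulAdele 1 α = α := by
  ext P; simp

/-- The functional `fω`, for a rational function `f`. -/
noncomputable def twist (ω : 𝓥.adeles →ₗ[k] k) : F →ₗ[k] 𝓥.adeles →ₗ[k] k :=
  (LinearMap.compRight k ω) ∘ₗ h.mulAdele

@[simp]
theorem twist_apply (ω : 𝓥.adeles →ₗ[k] k) (f : F) (α : 𝓥.adeles) :
    h.twist ω f α = ω (h.mulAdele f α) := rfl

theorem twist_twist (ω : 𝓥.adeles →ₗ[k] k) (f g : F) :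
    h.twist (h.twist ω f) g = h.twist ω (f * g) := by
  ext α; simp [mulAdele_mul]

theorem twist_one (ω : 𝓥.adeles →ₗ[k] k) : h.twist ω 1 = ω := by
  ext α; simp [mulAdele_one]

theorem twist_injective {ω : 𝓥.adeles →ₗ[k] k} (hω : ω ≠ 0) : Function.Injective (h.twist ω) := by
  rw [← LinearMap.ker_eq_bot, LinearMap.ker_eq_bot']
  intro f hf
  by_contra hf0
  apply hω
  rw [← h.twist_one ω, ← mul_inv_cancel₀ hf0, ← twist_twist, hf]
  ext α; simp

/-- The rational functions as adeles. -/
def principalAdele (f : F) : 𝓥.adeles := ⟨diag k F ι f, h.diag_mem_adeles f⟩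

omit h in
/-- The Weil differentials `ω` with `(ω) ≥ D`. -/
def weilDifferential (𝓥 : PlaceFamily k F ι) (D : ι →₀ ℤ) : Submodule k (Module.Dual k 𝓥.adeles) :=
  ((𝓥.box D ⊔ LinearMap.range (diag k F ι)).submoduleOf 𝓥.adeles).dualAnnihilator

theorem mem_weilDifferential {D : ι →₀ ℤ} {ω : 𝓥.adeles →ₗ[k] k} :
    ω ∈ weilDifferential 𝓥 D ↔
      (∀ α : 𝓥.adeles, α.1 ∈ 𝓥.box D → ω α = 0) ∧ ∀ f, ω (h.principalAdele f) = 0 := by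
  rw [weilDifferential, Submodule.mem_dualAnnihilator]
  constructor
  · intro hω
    exact ⟨fun α hα => hω α (Submodule.mem_sup_left (T := LinearMap.range (diag k F ι)) hα),
      fun f => hω (h.principalAdele f)
        (Submodule.mem_sup_right (S := 𝓥.box D) (LinearMap.mem_range_self _ f))⟩
  · rintro ⟨h1, h2⟩ α hα
    obtain ⟨β, hβ, _, ⟨f, rfl⟩, hs⟩ := Submodule.mem_sup.1 hα
    have : α = ⟨β, box_le_adeles D hβ⟩ + h.principalAdele f := Subtype.ext hs.symm
    rw [this, map_add, h1 _ hβ, h2, add_zero]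

theorem twist_mem_weilDifferential {D E : ι →₀ ℤ} {ω : 𝓥.adeles →ₗ[k] k}
    (hω : ω ∈ weilDifferential 𝓥 D) {f : F} (hf : f ∈ 𝓥.sections ⇑(D - E)) :
    h.twist ω f ∈ weilDifferential 𝓥 E := by
  rw [h.mem_weilDifferential] at hω ⊢
  constructor
  · intro α hα
    refine hω.1 _ fun P => ?_
    rw [mulAdele_apply, map_mul]
    calc 𝓥.v P f * 𝓥.v P (α.1 P) ≤ exp ((D - E) P) * exp (E P) := mul_le_mul' (hf P) (hα P)
      _ = exp (D P) := by rw [← exp_add]; simp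
  · intro g
    exact hω.2 (f * g)

variable [Nonempty ι]

/-- The Riemann-Roch theorem, in terms of the space of Weil differentials. -/
theorem exists_finrank_weilDifferential : ∃ M : ℤ, ∀ D : ι →₀ ℤ,
    Module.Finite k (weilDifferential 𝓥 D) ∧
      (Module.finrank k (weilDifferential 𝓥 D) : ℤ) = M - 𝓥.defect D := by
  obtain ⟨M, hM⟩ := h.exists_relLength_adeles
  refine ⟨M, fun D => ?_⟩
  obtain ⟨i, hi, hi'⟩ := hM D
  set W := (𝓥.box D ⊔ LinearMap.range (diag k F ι)).submoduleOf 𝓥.adeles with hW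
  have hfl : IsFiniteLength k (𝓥.adeles ⧸ W) := by
    rw [← Module.length_ne_top_iff]
    change relLength (𝓥.box D ⊔ LinearMap.range (diag k F ι)) 𝓥.adeles ≠ ⊤
    rw [hi]
    exact ENat.natCast_ne_top i
  have hfin : Module.Finite k (𝓥.adeles ⧸ W) := by
    have := (isFiniteLength_iff_isNoetherian_isArtinian.1 hfl).1
    infer_instance
  have hrank : Module.finrank k (𝓥.adeles ⧸ W) = i := by
    have h1 := Module.length_eq_finrank k (𝓥.adeles ⧸ W)
    have h2 : Module.length k (𝓥.adeles ⧸ W) = i := hi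
    rw [h2] at h1
    exact_mod_cast h1.symm
  -- The differentials are the dual of the adeles modulo `𝔸(D) + F`, whose dimension is known.
  have e := W.dualQuotEquivDualAnnihilator
  refine ⟨Module.Finite.equiv e, ?_⟩
  rw [← hi', ← hrank, ← Subspace.dual_finrank_eq (K := k) (V := 𝓥.adeles ⧸ W)]
  exact congrArg _ e.finrank_eq.symm

/-- The space of Weil differentials is one-dimensional over the function field. -/
theorem exists_eq_twist {D D' : ι →₀ ℤ} {ω ω' : 𝓥.adeles →ₗ[k] k} (hω0 : ω ≠ 0)
    (hω : ω ∈ weilDifferential 𝓥 D) (hω' : ω' ∈ weilDifferential 𝓥 D') :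
    ∃ g, ω' = h.twist ω g := by
  obtain ⟨M, hM⟩ := h.exists_finrank_weilDifferential
  have hdef : ∀ D, 𝓥.defect D ≤ M := fun D => by
    have := (hM D).2
    omega
  let P : ι := Classical.arbitrary ι
  set l := Module.finrank k (𝓥.sections 0)
  -- For `E = m P` the pairs `(f, g)` form a space of dimension at least `2 deg E + deg D + deg D' -
  -- 2 M`, and `f ω + g ω'` lies in a space of dimension at most `M + deg E + l`. This `m` makes the
  -- source larger, so some nontrivial combination vanishes.
  let m : ℕ := (3 * M + l - 𝓥.degree D - 𝓥.degree D' + 1).toNat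
  let E : ι →₀ ℤ := ofNat (Finsupp.single P m)
  have hdegE : (m : ℤ) ≤ 𝓥.degree E := by
    have := resDegree_pos h.finiteResidue P
    rw [degree_ofNat]
    simp only [effDegree, zero_mul, Finsupp.sum_single_index]
    exact_mod_cast Nat.le_mul_of_pos_right m this
  have hm : 3 * M + l - 𝓥.degree D - 𝓥.degree D' + 1 ≤ m := Int.self_le_toNat _
  let Φ : (𝓥.sections ⇑(D - -E) × 𝓥.sections ⇑(D' - -E)) →ₗ[k] weilDifferential 𝓥 (-E) :=
    LinearMap.coprod
      (((h.twist ω).domRestrict _).codRestrict _ fun f => h.twist_mem_weilDifferential hω f.2)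
      (((h.twist ω').domRestrict _).codRestrict _ fun f => h.twist_mem_weilDifferential hω' f.2)
  have hΦ : ¬ Function.Injective Φ := by
    intro hinj
    have := (hM (-E)).1
    have h0 := h.finite_sections (D - -E)
    have h0' := h.finite_sections (D' - -E)
    have h1 := LinearMap.finrank_le_finrank_of_injective hinj
    rw [Module.finrank_prod] at h1
    have h2 := (hM (-E)).2
    have h3 := hdef (D - -E)
    have h4 := hdef (D' - -E)
    have h5 : Module.finrank k (𝓥.sections ⇑(-E)) ≤ l := by
      have := h.finite_sections 0
      refine Submodule.finrank_mono (sections_mono fun P => ?_)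
      simp [E]
    rw [defect] at h2 h3 h4
    rw [degree_neg] at h2
    rw [degree_sub, degree_neg] at h3 h4
    have h1' := Int.ofNat_le.2 h1
    have h5' := Int.ofNat_le.2 h5
    rw [Nat.cast_add] at h1'
    linarith
  rw [injective_iff_map_eq_zero] at hΦ
  push Not at hΦ
  obtain ⟨⟨⟨f, hf⟩, ⟨g, hg⟩⟩, hfg, hne⟩ := hΦ
  have hsum : h.twist ω f + h.twist ω' g = 0 := congrArg Subtype.val hfg
  have hg0 : g ≠ 0 := by
    rintro rfl
    rw [map_zero, add_zero] at hsum
    have hf0 : f = 0 := h.twist_injective hω0 (by rw [hsum, map_zero])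
    subst hf0
    exact hne rfl
  refine ⟨-f * g⁻¹, ?_⟩
  have h1 : h.twist ω' g = h.twist ω (-f) := by
    rw [map_neg]; exact eq_neg_of_add_eq_zero_right hsum
  rw [← twist_twist, ← h1, twist_twist, mul_inv_cancel₀ hg0, twist_one]

/-- A canonical divisor of negative degree has degree `-2 ℓ(0)`. -/
theorem degree_canonical {K : ι →₀ ℤ} {ω : 𝓥.adeles →ₗ[k] k} (hω0 : ω ≠ 0)
    (hωF : ∀ f, ω (h.principalAdele f) = 0)
    (hωK : ∀ D : ι →₀ ℤ, (∀ α : 𝓥.adeles, α.1 ∈ 𝓥.box D → ω α = 0) ↔ D ≤ K)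
    (hK : 𝓥.degree K < 0) :
    𝓥.degree K = -2 * Module.finrank k (𝓥.sections 0) := by
  obtain ⟨M, hM⟩ := h.exists_finrank_weilDifferential
  have hωmem : ω ∈ weilDifferential 𝓥 K := h.mem_weilDifferential.2 ⟨(hωK K).2 le_rfl, hωF⟩
  -- The differential `g ω` has divisor `K - prin g`, again of degree `deg K`. Hence no nonzero
  -- differential is regular when `deg K < 0`.
  have key : ∀ D g, g ≠ 0 → h.twist ω g ∈ weilDifferential 𝓥 D → D + h.prin g ≤ K := by
    intro D g hg hmem
    rw [← hωK]
    intro α hα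
    have h1 : α = h.mulAdele g (h.mulAdele g⁻¹ α) := by
      rw [mulAdele_mul, mul_inv_cancel₀ hg, mulAdele_one]
    rw [h1]
    refine (h.mem_weilDifferential.1 hmem).1 _ fun P => ?_
    rw [← h.mul_mem_iff hg]
    simpa [hg] using hα P
  have h0 : Module.finrank k (weilDifferential 𝓥 0) = 0 := by
    have : weilDifferential 𝓥 0 = ⊥ := by
      rw [eq_bot_iff]
      intro ω' hω'
      obtain ⟨g, rfl⟩ := h.exists_eq_twist hω0 hωmem hω'
      by_contra hne
      have hg : g ≠ 0 := by
        rintro rfl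
        exact hne (by rw [map_zero]; exact Submodule.zero_mem _)
      have := 𝓥.degree_mono (key 0 g hg hω')
      rw [degree_add, degree_prin, degree_zero] at this
      omega
    rw [this]; exact finrank_bot k _
  have hsecK : Module.finrank k (𝓥.sections K) = 0 := by
    have : 𝓥.sections K = ⊥ := by
      rw [eq_bot_iff]
      intro f hf
      by_contra hne
      have hf0 : f ≠ 0 := hne
      have h1 : h.prin f ≤ K := by
        intro P
        rw [prin_apply, log_le_iff_le_exp (by simpa using hf0)]
        exact hf P
      have := 𝓥.degree_mono h1
      rw [degree_prin] at this
      omega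
    rw [this]; exact finrank_bot k _
  have hKrank : Module.finrank k (weilDifferential 𝓥 K) = Module.finrank k (𝓥.sections 0) := by
    have : weilDifferential 𝓥 K = (𝓥.sections 0).map (h.twist ω) := by
      ext ω'
      constructor
      · intro hω'
        obtain ⟨g, rfl⟩ := h.exists_eq_twist hω0 hωmem hω'
        refine ⟨g, fun P => ?_, rfl⟩
        rcases eq_or_ne g 0 with rfl | hg
        · simp
        · have := key K g hg hω' P
          rw [Finsupp.add_apply, prin_apply] at this
          rw [diag_apply, ← log_le_iff_le_exp (by simpa using hg)]
          simpa using this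
      · rintro ⟨g, hg, rfl⟩
        refine h.twist_mem_weilDifferential hωmem ?_
        rw [sub_self]
        exact hg
    rw [this]
    exact (Submodule.equivMapOfInjective _ (h.twist_injective hω0) _).finrank_eq.symm
  -- Riemann–Roch at `0` reads `0 = M + ℓ(0)`, and at `K` it reads `ℓ(0) = M - deg K`.
  have e0 := (hM 0).2
  have eK := (hM K).2
  rw [h0, defect, degree_zero] at e0
  rw [hKrank, defect, hsecK] at eK
  have e0' : ((0 : ℕ) : ℤ) = M - (0 - Module.finrank k (𝓥.sections 0)) := e0
  push_cast at e0' eK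
  linarith

omit [Nonempty ι] in
/-- The residue degrees are multiples of the degree of the field of constants. -/
theorem finrank_sections_zero_dvd (P : ι) : Module.finrank k (𝓥.sections 0) ∣ 𝓥.resDegree P := by
  -- The constants `k'` preserve the filtration at `P`, so the residue space is a `k'`-vector space
  -- and the tower law applies.
  let k' := algebraicClosure k F
  have hk' : ∀ (c : k') (n : ℤ) (x : F), 𝓥.v P x ≤ exp n → 𝓥.v P (c • x) ≤ exp n := by
    intro c n x hx
    change 𝓥.v P ((c : F) * x) ≤ _
    rw [map_mul]
    exact (mul_le_of_le_one_left'
      (le_one_of_isAlgebraic (mem_algebraicClosure_iff.1 c.2) P)).trans hx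
  let N : ℤ → Submodule k' F := fun n =>
    { carrier := {x | 𝓥.v P x ≤ exp n}
      zero_mem' := by simp
      add_mem' := fun ha hb => (𝓥.v P).map_add_le ha hb
      smul_mem' := fun c x hx => hk' c n x hx }
  let A := (N (-1)).submoduleOf (N 0)
  have hd : Module.finrank k (𝓥.sections 0) = Module.finrank k k' := by
    have : 𝓥.sections 0 = (Subalgebra.toSubmodule k'.toSubalgebra) := by
      ext x
      rw [h.mem_sections_zero_iff]
      exact mem_algebraicClosure_iff.symm
    rw [this]
    rfl
  have hr : Module.finrank k (N 0 ⧸ A) = 𝓥.resDegree P := by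
    have e : (𝓥.localIdeal P 0 ⧸ (𝓥.localIdeal P (-1)).submoduleOf (𝓥.localIdeal P 0)) ≃ₗ[k]
        (N 0 ⧸ A) := Submodule.Quotient.restrictScalarsEquiv k A
    have hfl := Module.length_ne_top_iff.1 (h.finiteResidue P)
    have hfin : Module.Finite k
        (𝓥.localIdeal P 0 ⧸ (𝓥.localIdeal P (-1)).submoduleOf (𝓥.localIdeal P 0)) := by
      have := (isFiniteLength_iff_isNoetherian_isArtinian.1 hfl).1
      infer_instance
    rw [← e.finrank_eq, resDegree, relLength, Module.length_eq_finrank, ENat.toNat_natCast]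
  rw [hd, ← hr, ← Module.finrank_mul_finrank k k' (N 0 ⧸ A)]
  exact dvd_mul_right _ _

end IsComplete

end PlaceFamily

end

/-! ### Closed points of the curve as discrete valuations. -/

namespace ProperRegularCurve

variable {k : Type u} [Field k] (C : ProperRegularCurve k)

theorem krullDim_eq_one : Order.krullDim C.X = 1 := by
  rw [← C.dim_eq_one, topologicalKrullDim]
  exact (Order.krullDim_eq_of_orderIso (irreducibleSetEquivPoints (α := C.X))).symm

theorem coheight_le_one (x : C.X) : Order.coheight x ≤ 1 := by
  have := Order.coheight_le_krullDim x
  rw [krullDim_eq_one] at this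
  exact_mod_cast this

theorem lt_genericPoint {x : C.X} (hx : x ≠ genericPoint C.X) : x < genericPoint C.X := by
  have h : genericPoint C.X ⤳ x := (genericPoint_spec C.X).specializes trivial
  exact lt_of_le_not_ge h fun h' => hx (Specializes.antisymm h' h).eq

/-- A further specialization of a nongeneric point would have codimension at least two. -/
theorem isClosed_singleton_of_ne {x : C.X} (hx : x ≠ genericPoint C.X) :
    IsClosed ({x} : Set C.X) := by
  rw [← closure_subset_iff_isClosed]
  intro y hy
  rw [Set.mem_singleton_iff]
  by_contra hne
  have hxy : x ⤳ y := specializes_iff_mem_closure.2 hy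
  have hlt : y < x := lt_of_le_not_ge hxy fun h' => hne (Specializes.antisymm h' hxy).eq
  have h1 := Order.coheight_add_one_le hlt
  have h2 := Order.coheight_add_one_le (C.lt_genericPoint hx)
  have h3 := C.coheight_le_one y
  have h4 : (2 : ℕ∞) ≤ 1 := by
    calc (2 : ℕ∞) = 0 + 1 + 1 := by norm_num
      _ ≤ Order.coheight (genericPoint C.X) + 1 + 1 := by gcongr; exact zero_le
      _ ≤ Order.coheight x + 1 := by gcongr
      _ ≤ _ := h1.trans h3
  exact absurd h4 (by decide)

theorem ne_genericPoint (P : C.ClosedPoint) : P.1 ≠ genericPoint C.X := by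
  intro h
  have h1 : (Set.univ : Set C.X) = {P.1} := by
    rw [← P.2.closure_eq, h]
    exact (genericPoint_spec C.X).def.symm
  have : Subsingleton C.X := by
    refine ⟨fun a b => ?_⟩
    have ha : a ∈ ({P.1} : Set C.X) := h1 ▸ Set.mem_univ a
    have hb : b ∈ ({P.1} : Set C.X) := h1 ▸ Set.mem_univ b
    rw [Set.mem_singleton_iff.1 ha, Set.mem_singleton_iff.1 hb]
  have h2 : Order.krullDim C.X ≤ 0 := Order.krullDim_nonpos_of_subsingleton
  rw [krullDim_eq_one] at h2
  exact absurd h2 (by decide)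

theorem coheight_closedPoint (P : C.ClosedPoint) : Order.coheight P.1 = 1 := by
  refine le_antisymm (C.coheight_le_one _) ?_
  exact le_trans (by simp) (Order.coheight_add_one_le (C.lt_genericPoint (C.ne_genericPoint P)))

instance (P : C.ClosedPoint) : IsDiscreteValuationRing (C.X.presheaf.stalk P.1) := by
  have := C.regular P.1
  rw [← IsLocalRing.finrank_CotangentSpace_eq_one_iff]
  have h := (IsRegularLocalRing.iff_finrank_cotangentSpace (R := C.X.presheaf.stalk P.1)).1 this
  rw [ringKrullDim_stalk_eq_coheight, coheight_closedPoint] at h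
  exact_mod_cast h

/-- The valuation of the function field at a closed point. -/
noncomputable def val (P : C.ClosedPoint) :
    Valuation C.X.functionField (WithZero (Multiplicative ℤ)) :=
  (IsDiscreteValuationRing.maximalIdeal (C.X.presheaf.stalk P.1)).valuation C.X.functionField

theorem val_le_one_iff (P : C.ClosedPoint) (f : C.X.functionField) :
    C.val P f ≤ 1 ↔ f ∈ (algebraMap (C.X.presheaf.stalk P.1) C.X.functionField).range := by
  constructor
  · intro h
    obtain ⟨a, ha⟩ := IsDiscreteValuationRing.exists_lift_of_le_one h
    exact ⟨a, ha⟩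
  · rintro ⟨a, rfl⟩
    exact IsDedekindDomain.HeightOneSpectrum.valuation_le_one _ _

theorem memAdele_iff (D : C.WeilDivisor ℤ) (α : C.ClosedPoint → C.X.functionField) :
    MemAdele D α ↔ ∀ P, C.val P (α P) ≤ WithZero.exp (D P) := by
  refine forall_congr' fun P => ?_
  rcases eq_or_ne (α P) 0 with h0 | h0
  · simp [h0]
  simp only [h0, false_or]
  have e : Scheme.ord (α P) P.1 = -WithZero.log (C.val P (α P)) := by
    rw [Scheme.ord_eq_iff (C.coheight_closedPoint P) h0]
    change Ring.ordFrac (C.X.presheaf.stalk P.1) (α P) = WithZero.exp _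
    rw [Ring.ordFrac_eq_valuation_inv, WithZero.exp_neg,
      WithZero.exp_log (by simpa using h0)]
    rfl
  rw [e, ← WithZero.log_le_iff_le_exp (by simpa using h0)]
  constructor <;> intro h <;> linarith

/-- The places of the function field defined by the closed points. -/
noncomputable def places : PlaceFamily k C.X.functionField C.ClosedPoint where
  v := C.val
  map_const P c := by
    rw [val_le_one_iff]
    exact ⟨C.toStalk P.1 c, C.algebraMap_toStalk P.1 c⟩
  surjective P := IsDedekindDomain.HeightOneSpectrum.valuation_surjective _ _

theorem adele_eq : C.adele = C.places.adeles := by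
  ext α
  rw [PlaceFamily.mem_adeles]
  change (∀ᶠ P in Filter.cofinite, _) ↔ _
  refine Filter.eventually_congr (Filter.Eventually.of_forall fun P => ?_)
  exact (C.val_le_one_iff P _).symm

end ProperRegularCurve

/-! ### Separatedness and properness in terms of valuations. -/

namespace ProperRegularCurve

variable {k : Type u} [Field k] (C : ProperRegularCurve k)

theorem fromSpecStalk_toBase (x : C.X) :
    C.X.fromSpecStalk x ≫ C.toBase = Spec.map (CommRingCat.ofHom (C.toStalk x)) := by
  apply ext_of_isAffine
  rw [Scheme.Hom.comp_appTop, Scheme.fromSpecStalk_appTop]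
  rw [← cancel_epi (Scheme.ΓSpecIso (CommRingCat.of k)).inv,
    ← Scheme.ΓSpecIso_inv_naturality]
  simp [toStalk]

theorem SpecMap_algebraMap_fromSpecStalk (x : C.X) :
    Spec.map (CommRingCat.ofHom (algebraMap (C.X.presheaf.stalk x) C.X.functionField)) ≫
      C.X.fromSpecStalk x = C.X.fromSpecStalk (genericPoint C.X) :=
  Scheme.SpecMap_stalkSpecializes_fromSpecStalk ((genericPoint_spec C.X).specializes trivial)

theorem places_independent : C.places.Independent := by
  intro P Q hPQ
  by_contra! hc
  have hle : ∀ a : C.X.presheaf.stalk P.1, algebraMap (C.X.presheaf.stalk P.1) C.X.functionField a ∈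
      (algebraMap (C.X.presheaf.stalk Q.1) C.X.functionField).range := by
    intro a
    rw [← val_le_one_iff]
    exact hc _ ((C.val_le_one_iff P _).2 ⟨a, rfl⟩)
  have hinj := IsFractionRing.injective (C.X.presheaf.stalk Q.1) C.X.functionField
  obtain ⟨ψ, hψ⟩ : ∃ ψ : C.X.presheaf.stalk P.1 →+* C.X.presheaf.stalk Q.1, ∀ a,
      algebraMap _ C.X.functionField (ψ a) =
        algebraMap (C.X.presheaf.stalk P.1) C.X.functionField a := by
    let e := RingEquiv.ofBijective (algebraMap (C.X.presheaf.stalk Q.1)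
      C.X.functionField).rangeRestrict ⟨fun a b hab => hinj (congrArg Subtype.val hab),
        RingHom.rangeRestrict_surjective _⟩
    refine ⟨e.symm.toRingHom.comp ((algebraMap (C.X.presheaf.stalk P.1)
      C.X.functionField).codRestrict _ hle), fun a => ?_⟩
    exact congrArg Subtype.val (e.apply_symm_apply ⟨_, hle a⟩)
  have hψk : ψ.comp (C.toStalk P.1) = C.toStalk Q.1 := by
    ext c
    apply hinj
    rw [RingHom.comp_apply, hψ, algebraMap_toStalk, algebraMap_toStalk]
  have hψF : (algebraMap (C.X.presheaf.stalk Q.1) C.X.functionField).comp ψ =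
      algebraMap (C.X.presheaf.stalk P.1) C.X.functionField := RingHom.ext hψ
  -- An inclusion of the local ring of `P` in that of `Q` yields a second morphism from the spectrum
  -- of the latter to `C`, equal to the canonical one at the generic point and over `k`.
  -- Separatedness identifies the two, so `Q` specializes to `P`; as `Q` is closed, `P = Q`.
  let S : ValuativeCommSq C.toBase :=
    { R := C.X.presheaf.stalk Q.1
      K := C.X.functionField
      i₁ := C.X.fromSpecStalk (genericPoint C.X)
      i₂ := Spec.map (CommRingCat.ofHom (C.toStalk Q.1))
      commSq := ⟨by
        rw [← C.fromSpecStalk_toBase Q.1, ← C.SpecMap_algebraMap_fromSpecStalk Q.1, Category.assoc]⟩ }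
  have hs : Subsingleton S.commSq.LiftStruct := IsSeparated.valuativeCriterion C.toBase S
  let l₁ : S.commSq.LiftStruct := ⟨C.X.fromSpecStalk Q.1,
    C.SpecMap_algebraMap_fromSpecStalk Q.1, C.fromSpecStalk_toBase Q.1⟩
  let l₂ : S.commSq.LiftStruct := ⟨Spec.map (CommRingCat.ofHom ψ) ≫ C.X.fromSpecStalk P.1, by
      change Spec.map _ ≫ _ = C.X.fromSpecStalk (genericPoint C.X)
      rw [← C.SpecMap_algebraMap_fromSpecStalk P.1, ← hψF, CommRingCat.ofHom_comp, Spec.map_comp,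
        Category.assoc], by
      change _ = Spec.map (CommRingCat.ofHom (C.toStalk Q.1))
      rw [Category.assoc, fromSpecStalk_toBase, ← hψk, CommRingCat.ofHom_comp, Spec.map_comp]⟩
  have hl : C.X.fromSpecStalk Q.1 = Spec.map (CommRingCat.ofHom ψ) ≫ C.X.fromSpecStalk P.1 :=
    congrArg CommSq.LiftStruct.l (Subsingleton.elim l₁ l₂)
  have hQ : Q.1 ∈ Set.range (C.X.fromSpecStalk P.1) := by
    rw [← Scheme.fromSpecStalk_closedPoint (X := C.X) (x := Q.1), hl]
    exact ⟨_, (Scheme.Hom.comp_apply _ _ _).symm⟩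
  rw [Scheme.range_fromSpecStalk] at hQ
  have h1 : P.1 ∈ closure ({Q.1} : Set C.X) := specializes_iff_mem_closure.1 hQ
  rw [Q.2.closure_eq] at h1
  exact hPQ (Subtype.ext h1)

theorem exists_pole (x : C.X.functionField) (hx : Transcendental k x) :
    ∃ P, 1 < C.places.v P x := by
  -- A transcendental `x` is not integral over `k`, and an integrally closed subring is the
  -- intersection of the valuation rings containing it.
  obtain ⟨V, hkV, hxV⟩ : ∃ V : ValuationSubring C.X.functionField,
      (∀ c : k, algebraMap k C.X.functionField c ∈ V) ∧ x ∉ V := by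
    let R := (integralClosure k C.X.functionField).toSubring
    have hxR : x ∉ R := fun h => hx (IsIntegral.isAlgebraic h)
    have : IsIntegrallyClosedIn R C.X.functionField :=
      inferInstanceAs (IsIntegrallyClosedIn (integralClosure k C.X.functionField) C.X.functionField)
    obtain ⟨V, hV, hxV⟩ := Subring.exists_le_valuationSubring_of_isIntegrallyClosedIn hxR
    exact ⟨V, fun c => hV (isIntegral_algebraMap (R := k)), hxV⟩
  let φ : k →+* V := (algebraMap k C.X.functionField).codRestrict V hkV
  have hφ : (algebraMap V C.X.functionField).comp φ = C.toStalk (genericPoint C.X) := rfl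
  let S : ValuativeCommSq C.toBase :=
    { R := V
      K := C.X.functionField
      i₁ := C.X.fromSpecStalk (genericPoint C.X)
      i₂ := Spec.map (CommRingCat.ofHom φ)
      commSq := ⟨by
        rw [C.fromSpecStalk_toBase, ← Spec.map_comp, ← CommRingCat.ofHom_comp, hφ]⟩ }
  have hE : ValuativeCriterion.Existence C.toBase := by
    have h := UniversallyClosed.eq_valuativeCriterion
    have h1 : UniversallyClosed C.toBase := inferInstance
    rw [h] at h1
    exact h1.1
  obtain ⟨⟨l, hl, -⟩⟩ := (hE S).exists_lift
  have hl : Spec.map (CommRingCat.ofHom (algebraMap V C.X.functionField)) ≫ l =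
    C.X.fromSpecStalk (genericPoint C.X) := hl
  -- The centre of `V`, which exists by properness. Its local ring lies in `V` and so misses `x`;
  -- thus `p` is not generic, hence closed, and `x` has a pole there.
  let p := l (IsLocalRing.closedPoint V)
  have hp : ∀ a, algebraMap (C.X.presheaf.stalk p) C.X.functionField a ∈ V := by
    have h1 : CommRingCat.ofHom (algebraMap (C.X.presheaf.stalk p) C.X.functionField) =
        Scheme.stalkClosedPointTo l ≫ CommRingCat.ofHom (algebraMap V C.X.functionField) := by
      apply Spec.map_injective
      rw [← cancel_mono (C.X.fromSpecStalk p), SpecMap_algebraMap_fromSpecStalk, Spec.map_comp,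
        Category.assoc, Scheme.Spec_stalkClosedPointTo_fromSpecStalk, hl]
    intro a
    have h2 := DFunLike.congr_fun (congrArg CommRingCat.Hom.hom h1) a
    have h3 : algebraMap (C.X.presheaf.stalk p) C.X.functionField a =
      algebraMap V C.X.functionField ((Scheme.stalkClosedPointTo l).hom a) := h2
    rw [h3]
    exact ((Scheme.stalkClosedPointTo l).hom a).2
  have hpg : p ≠ genericPoint C.X := by
    intro h
    have : ∀ q, q = genericPoint C.X → (∀ a, algebraMap (C.X.presheaf.stalk q)
        C.X.functionField a ∈ V) → x ∈ V := by
      rintro q rfl hq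
      have h1 := hq x
      have h2 : @algebraMap _ _ _ _ (stalkFunctionFieldAlgebra C.X (genericPoint C.X)) x = x := by
        change (C.X.presheaf.stalkSpecializes _).hom x = x
        rw [TopCat.Presheaf.stalkSpecializes_refl]
        rfl
      rwa [h2] at h1
    exact hxV (this p h hp)
  refine ⟨⟨p, C.isClosed_singleton_of_ne hpg⟩, ?_⟩
  by_contra hle
  obtain ⟨a, ha⟩ := (C.val_le_one_iff _ _).1 (not_lt.1 hle)
  exact hxV (ha ▸ hp a)

end ProperRegularCurve

/-! ### Residue fields and residue degrees. -/

namespace ProperRegularCurve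

variable {k : Type u} [Field k] (C : ProperRegularCurve k)

theorem finite_residueField (P : C.ClosedPoint) : Module.Finite k (C.X.residueField P.1) := by
  have h1 : C.X.fromSpecResidueField P.1 ≫ C.toBase =
      Spec.map (CommRingCat.ofHom (algebraMap k (C.X.residueField P.1))) := by
    have : CommRingCat.ofHom (algebraMap k (C.X.residueField P.1)) =
      CommRingCat.ofHom (C.toStalk P.1) ≫ C.X.residue P.1 := rfl
    rw [this, Spec.map_comp, ← fromSpecStalk_toBase, Scheme.fromSpecResidueField, Category.assoc]
  have h2 : IsFinite (C.X.fromSpecResidueField P.1 ≫ C.toBase) := by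
    have := isClosed_singleton_iff_isClosedImmersion.1 P.2
    rw [isFinite_iff_locallyOfFiniteType_of_jacobsonSpace]
    infer_instance
  rw [h1, IsFinite.SpecMap_iff] at h2
  exact RingHom.finite_algebraMap.1 h2

theorem val_algebraMap_lt_one_iff (P : C.ClosedPoint) (a : C.X.presheaf.stalk P.1) :
    C.val P (algebraMap _ C.X.functionField a) < 1 ↔ C.X.residue P.1 a = 0 := by
  rw [val, IsDedekindDomain.HeightOneSpectrum.valuation_lt_one_iff_mem]
  exact (IsLocalRing.residue_eq_zero_iff a).symm

/-- The residue field as a quotient of the local ring in the function field. -/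
theorem nonempty_linearEquiv_residueField (P : C.ClosedPoint) :
    Nonempty ((C.places.localIdeal P 0 ⧸
      (C.places.localIdeal P (-1)).submoduleOf (C.places.localIdeal P 0)) ≃ₗ[k]
      C.X.residueField P.1) := by
  have hinj := IsFractionRing.injective (C.X.presheaf.stalk P.1) C.X.functionField
  let : Algebra k (C.X.presheaf.stalk P.1) := (C.toStalk P.1).toAlgebra
  let f : C.X.presheaf.stalk P.1 →ₗ[k] C.X.functionField :=
    { toFun := algebraMap _ _
      map_add' := map_add _
      map_smul' := fun c a => by
        rw [Algebra.smul_def, map_mul, RingHom.id_apply, Algebra.smul_def]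
        congr 1
        exact C.algebraMap_toStalk P.1 c }
  let r : C.X.presheaf.stalk P.1 →ₗ[k] C.X.residueField P.1 :=
    { toFun := C.X.residue P.1
      map_add' := map_add _
      map_smul' := fun c a => by
        rw [Algebra.smul_def, map_mul, RingHom.id_apply, Algebra.smul_def]
        rfl }
  have hrange : LinearMap.range f = C.places.localIdeal P 0 := by
    ext x
    exact (C.val_le_one_iff P x).symm
  let e : C.X.presheaf.stalk P.1 ≃ₗ[k] C.places.localIdeal P 0 :=
    (LinearEquiv.ofInjective f hinj).trans (LinearEquiv.ofEq _ _ hrange)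
  have hr : Function.Surjective r := C.X.residue_surjective P.1
  refine ⟨LinearEquiv.trans (Submodule.Quotient.equiv _ (LinearMap.ker r) e.symm ?_)
    (r.quotKerEquivOfSurjective hr)⟩
  ext a
  obtain ⟨y, rfl⟩ := e.symm.surjective a
  obtain ⟨b, rfl⟩ := e.surjective y
  simp only [Submodule.mem_map_equiv, LinearEquiv.symm_symm, LinearEquiv.symm_apply_apply,
    LinearMap.mem_ker]
  change C.val P (algebraMap _ C.X.functionField b) ≤ WithZero.exp (-1) ↔ C.X.residue P.1 b = 0
  rw [← val_algebraMap_lt_one_iff]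
  rcases eq_or_ne (C.val P (algebraMap _ C.X.functionField b)) 0 with h0 | h0
  · simp [h0]
  · rw [← WithZero.log_le_iff_le_exp h0, ← WithZero.exp_zero, ← WithZero.log_lt_iff_lt_exp h0]
    omega

theorem relLength_eq_finrank (P : C.ClosedPoint) :
    Submodule.relLength (C.places.localIdeal P (-1)) (C.places.localIdeal P 0) =
      Module.finrank k (C.X.residueField P.1) := by
  obtain ⟨e⟩ := C.nonempty_linearEquiv_residueField P
  have := C.finite_residueField P
  rw [Submodule.relLength, e.length_eq, Module.length_eq_finrank]

theorem places_finiteResidue : C.places.FiniteResidue := fun P => by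
  rw [relLength_eq_finrank]
  exact ENat.natCast_ne_top _

theorem resDegree_eq (P : C.ClosedPoint) :
    C.places.resDegree P = Module.finrank k (C.X.residueField P.1) := by
  rw [PlaceFamily.resDegree, relLength_eq_finrank, ENat.toNat_natCast]

end ProperRegularCurve

/-! ### Finiteness of the function field over `k(x)`. -/

/-- A function field of one variable is finite over the subfield generated by any transcendental
element. -/
theorem finiteDimensional_adjoin_of_krullDimLE_one {k A F : Type*} [Field k] [CommRing A]
    [IsDomain A] [Algebra k A] [Algebra.FiniteType k A] [Ring.KrullDimLE 1 A] [Field F]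
    [Algebra A F] [IsFractionRing A F] [Algebra k F] [IsScalarTower k A F] (x : A)
    (hx : Transcendental k (algebraMap A F x)) :
    FiniteDimensional (IntermediateField.adjoin k {algebraMap A F x}) F := by
  have hinj := IsFractionRing.injective A F
  set y := algebraMap A F x with hy
  set E := IntermediateField.adjoin k {y}
  obtain ⟨s, hs⟩ := (inferInstance : Algebra.FiniteType k A).out
  -- This is `A` with the nonzero elements of `k[x]` inverted. The aim is `B = F`; Zariski's lemma
  -- then makes the finitely generated `E`-algebra `F` finite.
  let B : Subalgebra E F := Algebra.adjoin E (algebraMap A F '' s)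
  have hAB : ∀ a : A, algebraMap A F a ∈ B := by
    intro a
    have ha : a ∈ Algebra.adjoin k (s : Set A) := hs ▸ Algebra.mem_top
    induction ha using Algebra.adjoin_induction with
    | mem a ha => exact Algebra.subset_adjoin ⟨a, ha, rfl⟩
    | algebraMap c =>
      rw [← IsScalarTower.algebraMap_apply]
      exact B.algebraMap_mem (algebraMap k E c)
    | add a b _ _ ha hb => rw [map_add]; exact B.add_mem ha hb
    | mul a b _ _ ha hb => rw [map_mul]; exact B.mul_mem ha hb
  have haeval : ∀ p : Polynomial k, algebraMap A F (Polynomial.aeval x p) = Polynomial.aeval y p :=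
    fun p => (Polynomial.aeval_algebraMap_apply F x p).symm
  have hne : ∀ p : Polynomial k, p ≠ 0 → Polynomial.aeval y p ≠ 0 :=
    fun p hp h0 => hp ((transcendental_iff.1 hx) p h0)
  have hfrac : ∀ b ∈ B, ∃ p : Polynomial k, p ≠ 0 ∧ ∃ a : A,
      Polynomial.aeval y p * b = algebraMap A F a := by
    intro b hb
    induction hb using Algebra.adjoin_induction with
    | mem b hb =>
      obtain ⟨a, -, rfl⟩ := hb
      exact ⟨1, one_ne_zero, a, by simp⟩
    | algebraMap c =>
      obtain ⟨p, q, hpq⟩ := IntermediateField.mem_adjoin_simple_iff k (c : F) |>.1 c.2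
      by_cases hq : q = 0
      · refine ⟨1, one_ne_zero, 0, ?_⟩
        change _ * (c : F) = _
        rw [hpq, hq]; simp
      · refine ⟨q, hq, Polynomial.aeval x p, ?_⟩
        change _ * (c : F) = _
        rw [hpq, haeval, mul_div_cancel₀ _ (hne q hq)]
    | add b c _ _ hb hc =>
      obtain ⟨p, hp, a, ha⟩ := hb
      obtain ⟨q, hq, a', ha'⟩ := hc
      refine ⟨p * q, mul_ne_zero hp hq, Polynomial.aeval x q * a + Polynomial.aeval x p * a', ?_⟩
      simp only [map_add, map_mul, haeval, ← ha, ← ha']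
      ring
    | mul b c _ _ hb hc =>
      obtain ⟨p, hp, a, ha⟩ := hb
      obtain ⟨q, hq, a', ha'⟩ := hc
      refine ⟨p * q, mul_ne_zero hp hq, a * a', ?_⟩
      simp only [map_mul, ← ha, ← ha']
      ring
  let ψ : A →+* B := (algebraMap A F).codRestrict B.toSubring hAB
  have hunit : ∀ p : Polynomial k, p ≠ 0 → IsUnit (ψ (Polynomial.aeval x p)) := by
    intro p hp
    have hmem : Polynomial.aeval y p ∈ E := by
      have := (Polynomial.aeval (⟨y, IntermediateField.mem_adjoin_simple_self k y⟩ : E) p).2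
      convert this using 1
      exact (Polynomial.aeval_algebraMap_apply F
        (⟨y, IntermediateField.mem_adjoin_simple_self k y⟩ : E) p)
    have h0 : (⟨_, hmem⟩ : E) ≠ 0 := fun h => hne p hp (congrArg Subtype.val h)
    have h1 : ψ (Polynomial.aeval x p) = algebraMap E B ⟨_, hmem⟩ := Subtype.ext (haeval p)
    rw [h1]
    exact (isUnit_iff_ne_zero.2 h0).map _
  -- A nonzero prime of `B` would contract to a nonzero, hence maximal, prime `p` of `A`. By the
  -- Nullstellensatz `x` is algebraic over `k` modulo `p`, so `p` contains some `q(x)` with `q ≠ 0`,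
  -- a unit of `B`.
  have hfield : IsField B := by
    by_contra hnf
    obtain ⟨M, hMbot, hM⟩ := Ring.not_isField_iff_exists_prime.1 hnf
    let p := M.comap ψ
    have hp : p.IsPrime := inferInstance
    have hpbot : p ≠ ⊥ := by
      intro hp0
      apply hMbot
      rw [eq_bot_iff]
      intro b hb
      obtain ⟨q, hq, a, ha⟩ := hfrac b b.2
      have h1 : ψ (Polynomial.aeval x q) * b = ψ a := Subtype.ext (by
        change algebraMap A F _ * (b : F) = algebraMap A F a
        rw [haeval, ha])
      have h2 : a ∈ p := by
        change ψ a ∈ M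
        rw [← h1]; exact M.mul_mem_left _ hb
      rw [hp0, Ideal.mem_bot] at h2
      rw [h2, map_zero] at h1
      exact ((hunit q hq).mul_right_eq_zero).1 h1
    have hmax : p.IsMaximal := Ideal.IsPrime.isMaximal_of_ne_bot hp hpbot
    let := Ideal.Quotient.field p
    have hfin : Module.Finite k (A ⧸ p) := finite_of_finite_type_of_isJacobsonRing k (A ⧸ p)
    obtain ⟨q, hq, hq0⟩ := (Algebra.IsAlgebraic.isAlgebraic (R := k) (Ideal.Quotient.mk p x))
    have h3 : Polynomial.aeval x q ∈ p := by
      rw [← Ideal.Quotient.eq_zero_iff_mem, ← hq0]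
      exact (Polynomial.aeval_algebraMap_apply (A ⧸ p) x q).symm
    exact hM.ne_top (Ideal.eq_top_of_isUnit_mem _ h3 (hunit q hq))
  have htop : B = ⊤ := by
    rw [eq_top_iff]
    rintro z -
    obtain ⟨a, b, hb, rfl⟩ := IsFractionRing.div_surjective (A := A) z
    have hb0 : algebraMap A F b ≠ 0 := by
      rw [Ne, map_eq_zero_iff _ hinj]; exact nonZeroDivisors.ne_zero hb
    obtain ⟨c, hc⟩ := hfield.mul_inv_cancel
      (a := ⟨_, hAB b⟩) (fun h => hb0 (congrArg Subtype.val h))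
    have hc' : algebraMap A F b * (c : F) = 1 := congrArg Subtype.val hc
    rw [div_eq_mul_inv, inv_eq_of_mul_eq_one_right hc']
    exact B.mul_mem (hAB a) c.2
  have hft : Algebra.FiniteType E F := by
    refine ⟨⟨(s.finite_toSet.image (algebraMap A F)).toFinset, ?_⟩⟩
    rw [Set.Finite.coe_toFinset]
    exact htop
  exact finite_of_finite_type_of_isJacobsonRing E F

namespace ProperRegularCurve

variable {k : Type u} [Field k] (C : ProperRegularCurve k)

theorem finite_adjoin (x : C.X.functionField) (hx : Transcendental k x) :
    FiniteDimensional (IntermediateField.adjoin k {x}) C.X.functionField := by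
  obtain ⟨U, hU, f, hne, rfl, -⟩ := exists_isUnit_germ_eq C.X x
    (fun h => hx (h ▸ isAlgebraic_zero))
  have hU : IsAffineOpen U := hU
  have := functionField_isFractionRing_of_isAffineOpen C.X U hU
  let φ : k →+* Γ(C.X, U) :=
    ((Scheme.ΓSpecIso (CommRingCat.of k)).inv ≫ C.toBase.appLE ⊤ U (by simp)).hom
  let : Algebra k Γ(C.X, U) := φ.toAlgebra
  have : IsScalarTower k Γ(C.X, U) C.X.functionField := by
    refine IsScalarTower.of_algebraMap_eq' ?_
    have hgU : genericPoint C.X ∈ U :=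
      ((genericPoint_spec C.X).mem_open_set_iff U.isOpen).2 (by simpa using hne)
    have h1 := C.X.presheaf.germ_res (homOfLE le_top : U ⟶ ⊤) (genericPoint C.X) hgU
    exact congrArg (fun g => ((Scheme.ΓSpecIso (CommRingCat.of k)).inv ≫
      C.toBase.appTop ≫ g).hom) h1.symm
  have : Algebra.FiniteType k Γ(C.X, U) := by
    have h1 := LocallyOfFiniteType.finiteType_appLE C.toBase (isAffineOpen_top _) hU (by simp)
    refine RingHom.finiteType_algebraMap.1 ?_
    exact h1.comp (RingHom.FiniteType.of_surjective _
      (ConcreteCategory.bijective_of_isIso (Scheme.ΓSpecIso (CommRingCat.of k)).inv).2)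
  have : Ring.KrullDimLE 1 Γ(C.X, U) := by
    rw [Ring.krullDimLE_iff, ← PrimeSpectrum.topologicalKrullDim_eq_ringKrullDim]
    exact (hU.fromSpec.isOpenEmbedding.isInducing.topologicalKrullDim_le).trans C.dim_eq_one.le
  exact finiteDimensional_adjoin_of_krullDimLE_one (A := Γ(C.X, U)) f hx

theorem places_isComplete : C.places.IsComplete where
  finiteResidue := C.places_finiteResidue
  independent := C.places_independent
  finite_adjoin := C.finite_adjoin
  exists_pole := C.exists_pole

end ProperRegularCurve

/-! ### Finiteness of sums with terms in a DCC set. -/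

theorem IsDCC.isPWO {I : Set ℝ} (h : IsDCC I) : I.IsPWO := by
  rw [Set.isPWO_iff_isWF, Set.isWF_iff_no_descending_seq]
  rintro f hf hI
  obtain ⟨N, hN⟩ := h f hI hf.antitone
  exact (hf (Nat.lt_succ_self N)).ne' (hN N le_rfl)

/-- The tuples of given size and given sum with entries in a set with the descending chain
condition form a finite set. -/
theorem IsDCC.finite_tuples {I : Set ℝ} (h : IsDCC I) (n : ℕ) (c : ℝ) :
    {x : Fin n → ℝ | (∀ j, x j ∈ I) ∧ ∑ j, x j = c}.Finite := by
  have hpwo : {x : Fin n → ℝ | (∀ j, x j ∈ I) ∧ ∑ j, x j = c}.IsPWO := by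
    refine Set.IsPWO.mono (Set.IsPWO.pi fun _ => h.isPWO) (fun x hx j _ => hx.1 j)
  -- Comparable tuples with equal sums coincide, so the set is an antichain.
  refine IsAntichain.finite_of_partiallyWellOrderedOn (r := (· ≤ ·)) ?_ hpwo
  intro x hx y hy hxy hle
  refine hxy (funext fun j => ?_)
  exact (Finset.sum_eq_sum_iff_of_le fun j _ => hle j).1 (hx.2.trans hy.2.symm) j (Finset.mem_univ j)

theorem IsDCC.exists_pos_le {I : Set ℝ} (h : IsDCC I) : ∃ ε > 0, ∀ a ∈ I, 0 < a → ε ≤ a := by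
  have hwf : (I ∩ Set.Ioi 0).IsWF := h.isPWO.isWF.mono Set.inter_subset_left
  by_cases hne : (I ∩ Set.Ioi 0).Nonempty
  · exact ⟨hwf.min hne, (hwf.min_mem hne).2, fun a ha h0 => hwf.min_le hne ⟨ha, h0⟩⟩
  · exact ⟨1, one_pos, fun a ha h0 => absurd ⟨a, ha, h0⟩ hne⟩

/-- The numbers occurring in sums of positive elements with a given value form a finite set. -/
theorem IsDCC.exists_finite_of_sum_eq {I : Set ℝ} (h : IsDCC I) (c : ℝ) :
    ∃ I₀ : Set ℝ, I₀ ⊆ I ∧ I₀.Finite ∧ ∀ (T : Type u) [Fintype T] (x : T → ℝ),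
      (∀ t, x t ∈ I) → (∀ t, 0 < x t) → ∑ t, x t = c → ∀ t, x t ∈ I₀ := by
  obtain ⟨ε, hε, hI⟩ := h.exists_pos_le
  -- Each term is at least `ε`, so there are at most `c / ε` of them.
  refine ⟨⋃ n ∈ Finset.range (⌊c / ε⌋₊ + 1),
    ⋃ x ∈ {x : Fin n → ℝ | (∀ j, x j ∈ I) ∧ ∑ j, x j = c}, Set.range x, ?_, ?_, ?_⟩
  · intro a ha
    simp only [Set.mem_iUnion, Set.mem_range] at ha
    obtain ⟨n, -, x, hx, j, rfl⟩ := ha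
    exact hx.1 j
  · refine Set.Finite.biUnion (Finset.finite_toSet _) fun n _ => ?_
    exact (h.finite_tuples n c).biUnion fun x _ => Set.finite_range x
  · intro T _ x hx hpos hsum t
    let e := Fintype.equivFin T
    have hcard : (Fintype.card T : ℝ) * ε ≤ c := by
      rw [← hsum, ← nsmul_eq_mul, ← Finset.card_univ]
      exact Finset.card_nsmul_le_sum _ _ _ fun t _ => hI _ (hx t) (hpos t)
    simp only [Set.mem_iUnion]
    refine ⟨Fintype.card T, ?_, x ∘ e.symm, ⟨fun j => hx _, ?_⟩, e t, by simp⟩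
    · rw [Finset.mem_range, Nat.lt_succ_iff]
      exact Nat.le_floor ((le_div_iff₀ hε).2 hcard)
    · rw [← hsum]
      exact e.symm.sum_comp x

/-! ### From the degree equation to the theorem. -/

namespace ProperRegularCurve

variable {k : Type u} [Field k] {C : ProperRegularCurve k}

theorem WeilDivisor.degree_add (D D' : C.WeilDivisor ℝ) :
    WeilDivisor.degree (D + D') = WeilDivisor.degree D + WeilDivisor.degree D' :=
  Finsupp.sum_add_index' (by simp) (by intros; ring)

theorem WeilDivisor.degree_toReal (K : C.WeilDivisor ℤ) :
    WeilDivisor.degree (WeilDivisor.toReal K) = (C.places.degree K : ℝ) := by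
  rw [WeilDivisor.degree, WeilDivisor.toReal, Finsupp.sum_mapRange_index (by simp),
    PlaceFamily.degree, Finsupp.sum, Finsupp.sum]
  push_cast
  refine Finset.sum_congr rfl fun P _ => ?_
  rw [resDegree_eq, mul_comm]

/-- A canonical divisor of negative degree has degree `-2d`, where `d` divides all residue
degrees. -/
theorem IsCanonical.exists_degree_eq {K : C.WeilDivisor ℤ} (hK : IsCanonical K)
    [Nonempty C.ClosedPoint] (hneg : C.places.degree K < 0) :
    ∃ d : ℕ, C.places.degree K = -2 * d ∧ ∀ P, d ∣ C.places.resDegree P := by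
  have h := C.places_isComplete
  obtain ⟨ω, hω0, hωF, hωK⟩ := hK
  simp only [memAdele_iff] at hωK
  revert ω
  rw [C.adele_eq]
  intro ω hω0 hωF hωK
  exact ⟨_, h.degree_canonical hω0 (fun f => hωF _ ⟨f, fun P => rfl⟩) hωK hneg,
    h.finrank_sections_zero_dvd⟩

/-- The coefficients of the boundary, repeated according to suitable multiplicities, add up to
two. -/
theorem exists_multiplicities {K : C.WeilDivisor ℤ} {Δ : C.WeilDivisor ℝ} (hK : IsCanonical K)
    (hΔ : ∀ P ∈ Δ.support, 0 < Δ P) (hnt : WeilDivisor.IsNumTrivial (K.toReal + Δ))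
    (hne : Δ.support.Nonempty) :
    ∃ m : C.ClosedPoint → ℕ, (∀ P, 0 < m P) ∧ ∑ P ∈ Δ.support, m P * Δ P = 2 := by
  have : Nonempty C.ClosedPoint := ⟨hne.choose⟩
  have hpos : ∀ P, 0 < C.places.resDegree P :=
    PlaceFamily.resDegree_pos C.places_finiteResidue
  have hΔdeg : WeilDivisor.degree Δ = ∑ P ∈ Δ.support, (C.places.resDegree P : ℝ) * Δ P := by
    rw [WeilDivisor.degree, Finsupp.sum]
    exact Finset.sum_congr rfl fun P _ => by rw [resDegree_eq]
  have hΔpos : 0 < WeilDivisor.degree Δ := by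
    rw [hΔdeg]
    exact Finset.sum_pos (fun P hP => mul_pos (by exact_mod_cast hpos P) (hΔ P hP)) hne
  rw [WeilDivisor.IsNumTrivial, WeilDivisor.degree_add, WeilDivisor.degree_toReal] at hnt
  have hneg : C.places.degree K < 0 := by
    have : (C.places.degree K : ℝ) < 0 := by linarith
    exact_mod_cast this
  obtain ⟨d, hd, hdvd⟩ := hK.exists_degree_eq hneg
  choose m hm using hdvd
  have hd0 : (d : ℝ) ≠ 0 := by
    rintro h0
    have : d = 0 := by exact_mod_cast h0
    rw [hd, this] at hneg
    simp at hneg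
  refine ⟨m, fun P => Nat.pos_of_mul_pos_left (hm P ▸ hpos P), ?_⟩
  apply mul_left_cancel₀ hd0
  have h1 : WeilDivisor.degree Δ = d * ∑ P ∈ Δ.support, (m P : ℝ) * Δ P := by
    rw [hΔdeg, Finset.mul_sum]
    refine Finset.sum_congr rfl fun P _ => ?_
    rw [hm P]
    push_cast
    ring
  rw [← h1]
  rw [hd] at hnt
  push_cast at hnt
  linarith

end ProperRegularCurve

theorem mainTheorem7 (I : Set ℝ) (hI : I ⊆ Set.Icc 0 1) (hdcc : IsDCC I) :
    ∃ I₀ : Set ℝ, I₀ ⊆ I ∧ I₀.Finite ∧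
      ∀ (k : Type u) [Field k] (C : ProperRegularCurve k)
        (K : C.WeilDivisor ℤ) (Δ : C.WeilDivisor ℝ),
        ProperRegularCurve.IsCanonical K →
        Δ.coeffs ⊆ I →
        (K.toReal + Δ).IsNumTrivial →
        Δ.coeffs ⊆ I₀ := by
  obtain ⟨I₀, hI₀, hfin, h⟩ := IsDCC.exists_finite_of_sum_eq.{u} hdcc 2
  refine ⟨I₀, hI₀, hfin, fun k _ C K Δ hK hΔ hnt => ?_⟩
  rintro _ ⟨P, hP, rfl⟩
  have hmem : ∀ Q ∈ Δ.support, Δ Q ∈ I := fun Q hQ => hΔ ⟨Q, hQ, rfl⟩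
  have hpos : ∀ Q ∈ Δ.support, 0 < Δ Q := fun Q hQ =>
    lt_of_le_of_ne (hI (hmem Q hQ)).1 (Finsupp.mem_support_iff.1 hQ).symm
  obtain ⟨m, hm, hsum⟩ := ProperRegularCurve.exists_multiplicities hK hpos hnt ⟨P, hP⟩
  -- The coefficient at `Q` is repeated `m Q` times, turning the weighted sum into a plain sum equal
  -- to `2`.
  refine h (Σ Q : Δ.support, Fin (m Q)) (fun t => Δ t.1) (fun t => hmem _ t.1.2)
    (fun t => hpos _ t.1.2) ?_ ⟨⟨P, hP⟩, ⟨0, hm P⟩⟩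
  rw [← hsum, Fintype.sum_sigma, ← Finset.sum_coe_sort Δ.support]
  simp
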